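/- Let $K=\mathbb Q(\sqrt d)$ be a real quadratic field ($d>1$ a squarefree integer), let $\varepsilon=\frac{a+b\sqrt d}{2}$ with positive integers $a,b$ be a generator of the group $\mathcal O_{K,+}^\times$ of totally positive units, and let $\varepsilon'=\frac{a-b\sqrt d}{2}$; thus $\varepsilon+\varepsilon^{-1}=a$. Let $u$ be an integer with $|u|\ge 2$, let $\mathfrak f=(u)\subset\mathcal O_K$, and let $g=g(\mathfrak f)$ be the smallest positive integer with $\langle\varepsilon^{g}\rangle=\mathcal O_{K,+}^\times\cap(1+\mathfrak f)$. Put $(x_1,y_1)=(1,[\tfrac1u])$, where $[\cdot]$ is the fractional part in $[0,1)$, and $(x_{l+1},y_{l+1})=([a x_l+y_l]_1,[-x_l])$, where $[\cdot]_1$ agrees with $[\cdot]$ except that $[q]_1=1$ for $q\in\mathbb Z$; this is the normalized orbit of $(x_1,y_1)$ under right multiplication by $U=\begin{pmatrix}a&-1\\1&0\end{pmatrix}$. Assume that the orbit is $\{(x_l,y_l)\}_{1\le l\le g}$, i.e. $(x_{g+1},y_{g+1})=(x_1,y_1)$; this is automatic if $\mathcal O_K=\mathbb Z+\mathbb Z\varepsilon$.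 Define $$X_1(\mathfrak f)=\prod_{l=1}^{g}\mathcal S(\varepsilon,x_l\varepsilon+y_l),\qquad X_2(\mathfrak f)=\prod_{l=1}^{g}\mathcal S(\varepsilon',x_l\varepsilon'+y_l),$$ where $\mathcal S(\omega,z)=\Gamma_2(1+\omega-z\mid 1,\omega)/\Gamma_2(z\mid 1,\omega)$ is the double sine function, $\Gamma_2(z\mid 1,\omega)=\exp\bigl(\partial_s\zeta_2(s,z\mid1,\omega)|_{s=0}\bigr)$, and $\zeta_2(s,z\mid 1,\omega)$ is the meromorphic continuation of $\sum_{m,n\ge0}(z+m+n\omega)^{-s}$. Let $T_n$ be the polynomials with $T_n(x+x^{-1})=x^n+x^{-n}$, let $\mathfrak t_n=T_{n-1}(a)/T_n(a)$, and for a rational number $t$ with denominator $N$ in lowest terms put $$\mathrm D_t(z)=\prod_{k=1}^{N-1}\bigl(1-e^{2\pi i(kt+z)}\bigr)^{k/N}$$ (principal powers). Then $\mathrm D_{\mathfrak t_{n+g}}(\tfrac1u)\ne0$ for infinitely many $n$, and $$X_1(\mathfrak f)=X_2(\mathfrak f)=\lim_{n\to\infty}\left|\frac{\mathrm D_{\mathfrak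 t_n}(\frac1u)}{\mathrm D_{\mathfrak t_{n+g}}(\frac1u)}\right|,$$ where the limit is taken over those $n$ with $\mathrm D_{\mathfrak t_{n+g}}(\tfrac1u)\neq0$. -/

import Mathlib

open Filter Topology

noncomputable section

namespace Shintani

/-! ### The double sine function -/

/-- `F` is the meromorphic continuation to `Re s > -1`, holomorphic away from `s = 1` and `s = 2`,
of the Barnes double zeta function `∑_{m, n ≥ 0} (z + m + n ω) ^ (-s)` (`ω, z > 0`, `Re s > 2`).
Such an `F` is unique on this (connected) domain, which contains `s = 0`. -/
def IsDoubleZeta (ω z : ℝ) (F : ℂ → ℂ) : Prop :=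
  DifferentiableOn ℂ F {s : ℂ | -1 < s.re ∧ s ≠ 1 ∧ s ≠ 2} ∧
    ∀ s : ℂ, 2 < s.re →
      HasSum (fun p : ℕ × ℕ => (((z + p.1 + p.2 * ω : ℝ) : ℂ)) ^ (-s)) (F s)

/-- The (continued) Barnes double zeta function with periods `1, ω`. -/
def doubleZeta (ω z : ℝ) : ℂ → ℂ :=
  Classical.epsilon (IsDoubleZeta ω z)

/-- The double gamma function `Γ₂(z | 1, ω) = exp (∂ζ₂(s, z | 1, ω)/∂s at s = 0)`. -/
def doubleGamma (ω z : ℝ) : ℂ :=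
  Complex.exp (deriv (doubleZeta ω z) 0)

/-- The double sine function `𝒮(ω, z) = Γ₂(1 + ω - z | 1, ω) / Γ₂(z | 1, ω)`,
for `0 < ω` and `0 < z < 1 + ω`. -/
def doubleSine (ω z : ℝ) : ℂ :=
  doubleGamma ω (1 + ω - z) / doubleGamma ω z

/-! ### The decomposition datum and Shintani's invariants -/

/-- The fractional part normalized to lie in `(0, 1]`. -/
def fractOne (q : ℚ) : ℚ :=
  if Int.fract q = 0 then 1 else Int.fract q

/-- The pair `(x, y)` attached to the generator `u + v √d` of `𝔣`, where `ε = (a + b √d) / 2` and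
`N(𝔣) = |u² - d v²|`. -/
def initialPair (d a b : ℕ) (u v : ℤ) : ℚ × ℚ :=
  (fractOne (-(2 * v) / (b * (|u ^ 2 - d * v ^ 2| : ℤ))),
    Int.fract ((b * u + a * v) / (b * (|u ^ 2 - d * v ^ 2| : ℤ))))

/-- The matrix `U = (a, -1; 1, 0)`. -/
def matU (a : ℕ) : Matrix (Fin 2) (Fin 2) ℚ :=
  !![(a : ℚ), -1; 1, 0]

/-- One step of the action of `U` on normalized pairs: the row vector `(x, y)` goes to
`(x, y) U = (a x + y, -x)`, whose coordinates are then reduced modulo `1` to `(0, 1]` and `[0, 1)`.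
If `ε = [[a]]`, so that `ε² = a ε - 1`, this is multiplication of `x ε + y` by `ε`. -/
def orbitStep (a : ℕ) (p : ℚ × ℚ) : ℚ × ℚ :=
  (fractOne (Matrix.vecMul ![p.1, p.2] (matU a) 0),
    Int.fract (Matrix.vecMul ![p.1, p.2] (matU a) 1))

/-- `∏_{l = 1}^{g} 𝒮(ω, x_l ω + y_l)`, where `(x_1, y_1) = p` and `(x_l, y_l)` runs through the
normalized orbit of `p` under `U`. -/
def orbitProduct (a g : ℕ) (p : ℚ × ℚ) (ω : ℝ) : ℂ :=
  ∏ l ∈ Finset.range g,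
    doubleSine ω ((((orbitStep a)^[l] p).1 : ℝ) * ω + (((orbitStep a)^[l] p).2 : ℝ))

/-- `X₁(𝔣)` for `𝔣 = (u + v √d)`: the orbit product at `ε = (a + b √d) / 2`, where `g = g(𝔣)`. -/
def X₁ (d a b : ℕ) (u v : ℤ) (g : ℕ) : ℂ :=
  orbitProduct a g (initialPair d a b u v) ((a + b * Real.sqrt d) / 2)

/-- `X₂(𝔣)` for `𝔣 = (u + v √d)`: the orbit product at `ε' = (a - b √d) / 2`, where `g = g(𝔣)`. -/
def X₂ (d a b : ℕ) (u v : ℤ) (g : ℕ) : ℂ :=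
  orbitProduct a g (initialPair d a b u v) ((a - b * Real.sqrt d) / 2)

/-! ### Units -/

/-- Positivity under every real embedding. -/
def TotallyPositive {K : Type*} [Field K] (w : K) : Prop :=
  ∀ φ : K →+* ℝ, 0 < φ w

/-- `g(𝔣)`: the least `m ≥ 1` such that `ε ^ m` generates the group of totally positive units
that are congruent to `1` modulo `𝔣`. -/
def IsUnitIndex {K : Type*} [Field K] (ε : (NumberField.RingOfIntegers K)ˣ)
    (𝔣 : Ideal (NumberField.RingOfIntegers K)) (g : ℕ) : Prop :=
  IsLeast {m : ℕ | 0 < m ∧ ∀ w : (NumberField.RingOfIntegers K)ˣ,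
    w ∈ Subgroup.zpowers (ε ^ m) ↔
      TotallyPositive ((w : NumberField.RingOfIntegers K) : K) ∧
        (w : NumberField.RingOfIntegers K) - 1 ∈ 𝔣} g

/-! ### The cyclic quantum dilogarithm -/

/-- `D_t(x, y) = ∏_{k = 1}^{n - 1} (1 - exp (2 π i (k t + x t + y))) ^ (k / n)` for a rational `t`
with denominator `n` in lowest terms. -/
def cyclicDilog₂ (t : ℚ) (x y : ℝ) : ℂ :=
  ∏ k ∈ Finset.Ico 1 t.den,
    (1 - Complex.exp (2 * Real.pi * Complex.I * ((k * t + x * t + y : ℝ) : ℂ))) ^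
      ((k : ℂ) / (t.den : ℂ))

/-- The cyclic quantum dilogarithm in one variable,
`D_t(z) = D_t(0, z) = ∏_{k = 1}^{n - 1} (1 - exp (2 π i (k t + z))) ^ (k / n)`. -/
def cyclicDilog (t : ℚ) (z : ℝ) : ℂ :=
  cyclicDilog₂ t 0 z

/-- `𝔱_n = T_{n-1}(a) / T_n(a)`, where `T_n (x + x⁻¹) = x ^ n + x ^ (-n)`; these polynomials are
Mathlib's rescaled Chebyshev polynomials `Polynomial.Chebyshev.C`. -/
def tSeq (a n : ℕ) : ℚ :=
  (Polynomial.Chebyshev.C ℚ ((n : ℤ) - 1)).eval (a : ℚ) /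
    (Polynomial.Chebyshev.C ℚ (n : ℤ)).eval (a : ℚ)

end Shintani

end

open Filter Topology

noncomputable section

namespace Shintani

open MeasureTheory Set

/-! ### The integral representing the logarithm of the double sine function -/

/-! The logarithm of the double sine function is the convergent integral `logSine`
(`doubleSine_eq`): the Barnes zeta function is a Mellin transform, and removing the polar part of
its generating function makes the derivative at `s = 0` explicit. Both claims thus concern sums of
`logSine` over a closed orbit. Identities between hyperbolic functions under the integral sign give
homogeneity (`logSine_inv`), a multiplication formula in the period (`logSine_eq_sum`) and the two
difference equations (`logSine_add_period`, `logSine_add_one`).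

Equality of the two products: a totally positive unit has norm `1` (`sq_sub_eq_four`), so `ε' =
ε⁻¹`, and homogeneity turns the passage from `ε` to `ε'` into the exchange of `x` and `y` in `z = x
ω + y`. Modulo `1` this exchange conjugates `U` to `U⁻¹`, hence reverses orbits; it sends `(1,
[1/u])` to its own successor, so it permutes the closed orbit. The discrepancies caused by the
normalization at `x = 1` and `y = 0` cancel telescopically (`logSinePair_swapPair`).

The limit: for coprime `p, q`, `logSine_rat` expresses `logSine (p / q) (x p / q + y)` as `-log
|D_{p/q}| - log |D_{q/p}|` at suitable arguments, plus terms depending on `J = p x + q y` modulo `1`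
only through a log-sine and a bounded function. Take for `p, q, q'` three consecutive denominators
`tDen` in decreasing order; then `p / q → ε`. The recurrence `p = a q - q'` converts `D_{p/q}` at
one pair into the inverse of `D_{q'/q}` at the next pair of the orbit (`logDilog_reflect`), and the
large log-sine terms cancel. So each `logSine` is a difference of consecutive `dilogPair` values up
to `O(1/q)` (`abs_logSinePair_sub_le`). If the index of the denominators increases while the orbit
is traversed backwards, the sum telescopes to `log |D_{t_n}(1/u) / D_{t_{n+g}}(1/u)|`.

Along this path `J` modulo `1` is constant, equal to `tDen a (n + g) / u`. It is nonintegral exactly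
when `D_{t_{n+g}}(1/u) ≠ 0`, and it takes finitely many values modulo `1`, so the error is uniform.
Continuity of `logSine` in the period (`tendsto_logSine`) finishes the argument. Nonvanishing holds
infinitely often because consecutive denominators are coprime and the sequence is periodic modulo
`u`. -/

/-- The integrand of the integral representation of the logarithm of the double sine function. -/
def sineKernel (ω z t : ℝ) : ℝ :=
  (Real.sinh ((z - (1 + ω) / 2) * t) / (2 * Real.sinh (t / 2) * Real.sinh (ω * t / 2)) -
    (2 * z - 1 - ω) / (ω * t)) / t

/-- The logarithm of the double sine function, as an integral. -/
def logSine (ω z : ℝ) : ℝ :=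
  ∫ t in Ioi 0, sineKernel ω z t

/-! ### Bounds for the integrand, uniform in the period, and continuity of the integral. -/

theorem abs_exp_sub_sum_le (x : ℝ) (n : ℕ) :
    |Real.exp x - ∑ m ∈ Finset.range n, x ^ m / m.factorial| ≤ |x| ^ n * Real.exp |x| := by
  have h := Complex.norm_exp_sub_sum_le_norm_mul_exp (x : ℂ) n
  have e : Complex.exp (x : ℂ) - ∑ m ∈ Finset.range n, (x : ℂ) ^ m / m.factorial =
      ((Real.exp x - ∑ m ∈ Finset.range n, x ^ m / m.factorial : ℝ) : ℂ) := by
    push_cast; rfl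
  rwa [e, Complex.norm_real, Complex.norm_real, Real.norm_eq_abs, Real.norm_eq_abs] at h

theorem abs_sinh_le (x : ℝ) : |Real.sinh x| ≤ |x| * Real.exp |x| := by
  have h1 := abs_exp_sub_sum_le x 1
  have h2 := abs_exp_sub_sum_le (-x) 1
  simp only [abs_neg, Finset.sum_range_succ, Finset.sum_range_zero, Nat.factorial] at h1 h2
  norm_num at h1 h2
  rw [Real.sinh_eq, abs_le] at *
  constructor <;> linarith [h1.1, h1.2, h2.1, h2.2]

theorem abs_sinh_sub_self_le (x : ℝ) : |Real.sinh x - x| ≤ |x| ^ 3 * Real.exp |x| := by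
  have h1 := abs_exp_sub_sum_le x 3
  have h2 := abs_exp_sub_sum_le (-x) 3
  simp only [abs_neg, Finset.sum_range_succ, Finset.sum_range_zero, Nat.factorial] at h1 h2
  norm_num at h1 h2
  rw [Real.sinh_eq, abs_le] at *
  constructor <;> linarith [h1.1, h1.2, h2.1, h2.2]

theorem inv_sinh_le {t : ℝ} (ht : 0 < t) : 1 / (2 * Real.sinh (t / 2)) ≤ 1 / t := by
  apply one_div_le_one_div_of_le ht
  have := Real.self_le_sinh_iff.2 (half_pos ht).le
  linarith

theorem inv_sub_inv_sinh_le {t : ℝ} (ht : 0 < t) :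
    1 / t - 1 / (2 * Real.sinh (t / 2)) ≤ t * Real.exp (t / 2) / 4 := by
  have h1 : t / 2 ≤ Real.sinh (t / 2) := Real.self_le_sinh_iff.2 (half_pos ht).le
  have h2 := (abs_le.1 (abs_sinh_sub_self_le (t / 2))).2
  rw [abs_of_pos (half_pos ht)] at h2
  have hs : 0 < Real.sinh (t / 2) := by linarith
  rw [div_sub_div _ _ ht.ne' (by positivity), div_le_iff₀ (by positivity)]
  have hE := Real.exp_pos (t / 2)
  have : t * Real.exp (t / 2) / 4 * (t * (2 * (t / 2))) ≤
      t * Real.exp (t / 2) / 4 * (t * (2 * Real.sinh (t / 2))) := by gcongr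
  nlinarith

theorem sinh_half_pos {t : ℝ} (ht : 0 < t) : 0 < Real.sinh (t / 2) :=
  Real.sinh_pos_iff.2 (half_pos ht)

theorem abs_sineKernel_le_of_le_one {m M ω z t : ℝ} (hm : 0 < m) (hω : ω ∈ Icc m M)
    (hz : |z - (1 + ω) / 2| ≤ (1 + M) / 2) (ht : 0 < t) (ht1 : t ≤ 1) :
    |sineKernel ω z t| ≤
      2 * ((1 + M) / 2) ^ 3 * Real.exp ((1 + M) / 2) / m +
      2 * ((1 + M) / 2) * Real.exp ((1 + M) / 2) * (Real.exp 1 / 4) / m +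
      2 * ((1 + M) / 2) * Real.exp ((1 + M) / 2) * (M * Real.exp M / 4) := by
  obtain ⟨hω1, hω2⟩ := hω
  have hω0 : 0 < ω := hm.trans_le hω1
  have hM : 0 < M := hω0.trans_le hω2
  set G := (1 + M) / 2 with hG
  have hG0 : 0 < G := by positivity
  set γ := z - (1 + ω) / 2 with hγ
  set σ := 1 / (2 * Real.sinh (t / 2)) with hσ
  set τ := 1 / (2 * Real.sinh (ω * t / 2)) with hτ
  have hωt : 0 < ω * t := by positivity
  have hs1 := sinh_half_pos ht
  have hs2 := sinh_half_pos hωt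
  -- Replacing the two reciprocal hyperbolic sines one at a time by `1 / t` and `1 / (ω t)` leaves
  -- three terms of size `O(t)`; the final division by `t` then gives a constant bound.
  have key : sineKernel ω z t = (2 * (Real.sinh (γ * t) - γ * t) / (ω * t ^ 2) -
      2 * Real.sinh (γ * t) * (1 / t - σ) / (ω * t) -
      2 * Real.sinh (γ * t) * (1 / (ω * t) - τ) * σ) / t := by
    rw [sineKernel, hσ, hτ, ← hγ]
    have : 2 * z - 1 - ω = 2 * γ := by rw [hγ]; ring
    rw [this]
    field_simp
    ring
  have hγt : |γ * t| ≤ G * t := by rw [abs_mul, abs_of_pos ht]; gcongr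
  have hγt' : |γ * t| ≤ G := hγt.trans (by nlinarith)
  have b1 : |Real.sinh (γ * t) - γ * t| ≤ (G * t) ^ 3 * Real.exp G :=
    (abs_sinh_sub_self_le _).trans (by gcongr)
  have b2 : |Real.sinh (γ * t)| ≤ (G * t) * Real.exp G :=
    (abs_sinh_le _).trans (by gcongr)
  have b3 : |1 / t - σ| ≤ t * Real.exp 1 / 4 := by
    rw [abs_of_nonneg (sub_nonneg.2 (inv_sinh_le ht))]
    refine (inv_sub_inv_sinh_le ht).trans ?_
    gcongr
    linarith
  have b4 : |1 / (ω * t) - τ| ≤ (M * t) * Real.exp M / 4 := by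
    rw [abs_of_nonneg (sub_nonneg.2 (inv_sinh_le hωt))]
    refine (inv_sub_inv_sinh_le hωt).trans ?_
    gcongr
    nlinarith
  have b5 : |σ| ≤ 1 / t := by
    rw [abs_of_nonneg (by positivity)]; exact inv_sinh_le ht
  rw [key, abs_div, abs_of_pos ht, div_le_iff₀ ht]
  refine (abs_sub _ _).trans ((add_le_add (abs_sub _ _) le_rfl).trans ?_)
  rw [add_mul, add_mul]
  refine add_le_add (add_le_add ?_ ?_) ?_
  · rw [abs_div, abs_mul, abs_of_pos (show (0 : ℝ) < 2 by norm_num),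
      abs_of_pos (show 0 < ω * t ^ 2 by positivity)]
    calc 2 * |Real.sinh (γ * t) - γ * t| / (ω * t ^ 2)
        ≤ 2 * ((G * t) ^ 3 * Real.exp G) / (m * t ^ 2) := by gcongr
      _ = _ := by field_simp
  · rw [abs_div, abs_mul, abs_mul, abs_of_pos (show (0 : ℝ) < 2 by norm_num), abs_of_pos hωt]
    calc 2 * |Real.sinh (γ * t)| * |1 / t - σ| / (ω * t)
        ≤ 2 * ((G * t) * Real.exp G) * (t * Real.exp 1 / 4) / (m * t) := by gcongr
      _ = _ := by field_simp
  · rw [abs_mul, abs_mul, abs_mul, abs_of_pos (show (0 : ℝ) < 2 by norm_num)]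
    calc 2 * |Real.sinh (γ * t)| * |1 / (ω * t) - τ| * |σ|
        ≤ 2 * ((G * t) * Real.exp G) * ((M * t) * Real.exp M / 4) * (1 / t) := by gcongr
      _ = _ := by field_simp

theorem exp_mul_le_two_mul_sinh {m ω t : ℝ} (hω : m ≤ ω) (hm : 0 < m) (ht : 1 ≤ t) :
    Real.exp (ω * t / 2) * (1 - Real.exp (-m)) ≤ 2 * Real.sinh (ω * t / 2) := by
  have h : Real.exp (-(ω * t / 2)) = Real.exp (ω * t / 2) * Real.exp (-(ω * t)) := by
    rw [← Real.exp_add]; ring_nf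
  rw [Real.sinh_eq, h]
  have : Real.exp (-(ω * t)) ≤ Real.exp (-m) := by
    apply Real.exp_le_exp.2; nlinarith
  have := Real.exp_pos (ω * t / 2)
  nlinarith

/-- The numerator grows at most like `exp (((1 + ω) / 2 - δ) t)` and the denominator like `exp ((1 +
ω) t / 2)`, so the margin `δ` of `z` from the ends of `(0, 1 + ω)` is the rate of decay. The
subtracted term contributes `t⁻²`. -/
theorem abs_sineKernel_le_of_one_le {m M δ ω z t : ℝ} (hm : 0 < m) (hω : ω ∈ Icc m M)
    (hz : |z - (1 + ω) / 2| ≤ (1 + ω) / 2 - δ) (hz' : |z - (1 + ω) / 2| ≤ (1 + M) / 2)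
    (ht1 : 1 ≤ t) :
    |sineKernel ω z t| ≤
      1 / ((1 - Real.exp (-1)) * (1 - Real.exp (-m))) * Real.exp (-δ * t) +
      (1 + M) / m * t ^ (-2 : ℝ) := by
  obtain ⟨hω1, hω2⟩ := hω
  have hω0 : 0 < ω := hm.trans_le hω1
  have hM : 0 < M := hω0.trans_le hω2
  have ht : 0 < t := by linarith
  set γ := z - (1 + ω) / 2 with hγ
  have hωt : 0 < ω * t := by positivity
  have hs1 := sinh_half_pos ht
  have hs2 := sinh_half_pos hωt
  have e1 : 0 < 1 - Real.exp (-1) := by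
    rw [sub_pos, Real.exp_lt_one_iff]; norm_num
  have e2 : 0 < 1 - Real.exp (-m) := by
    rw [sub_pos, Real.exp_lt_one_iff]; linarith
  have h1 := exp_mul_le_two_mul_sinh (m := 1) (ω := 1) le_rfl one_pos ht1
  rw [one_mul] at h1
  have h2 := exp_mul_le_two_mul_sinh hω1 hm ht1
  have h3 : |2 * Real.sinh (γ * t)| ≤ Real.exp (((1 + ω) / 2 - δ) * t) := by
    have ha : Real.exp (γ * t) ≤ Real.exp (((1 + ω) / 2 - δ) * t) := by
      apply Real.exp_le_exp.2; nlinarith [le_abs_self γ]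
    have hb : Real.exp (-(γ * t)) ≤ Real.exp (((1 + ω) / 2 - δ) * t) := by
      apply Real.exp_le_exp.2; nlinarith [neg_abs_le γ]
    have := Real.exp_pos (γ * t)
    have := Real.exp_pos (-(γ * t))
    rw [Real.sinh_eq, abs_le]
    constructor <;> linarith
  have key : sineKernel ω z t = 2 * Real.sinh (γ * t) /
      ((2 * Real.sinh (t / 2)) * (2 * Real.sinh (ω * t / 2))) / t - 2 * γ / (ω * t ^ 2) := by
    rw [sineKernel, ← hγ]
    have : 2 * z - 1 - ω = 2 * γ := by rw [hγ]; ring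
    rw [this]
    field_simp
  rw [key]
  refine (abs_sub _ _).trans (add_le_add ?_ ?_)
  · rw [abs_div, abs_of_pos ht, abs_div,
      abs_of_pos (show 0 < (2 * Real.sinh (t / 2)) * (2 * Real.sinh (ω * t / 2)) by positivity)]
    refine (div_le_self (by positivity) ht1).trans ?_
    calc |2 * Real.sinh (γ * t)| / ((2 * Real.sinh (t / 2)) * (2 * Real.sinh (ω * t / 2)))
        ≤ Real.exp (((1 + ω) / 2 - δ) * t) / ((Real.exp (t / 2) * (1 - Real.exp (-1))) *
          (Real.exp (ω * t / 2) * (1 - Real.exp (-m)))) := by gcongr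
      _ = _ := by
        have : Real.exp (((1 + ω) / 2 - δ) * t) =
            Real.exp (t / 2) * Real.exp (ω * t / 2) * Real.exp (-δ * t) := by
          rw [← Real.exp_add, ← Real.exp_add]; ring_nf
        rw [this]
        field_simp
  · rw [Real.rpow_neg ht.le, show (2 : ℝ) = ((2 : ℕ) : ℝ) by norm_num, Real.rpow_natCast,
      abs_div, abs_of_pos (show 0 < ω * t ^ 2 by positivity), abs_mul]
    push_cast
    rw [abs_of_pos (show (0 : ℝ) < 2 by norm_num)]
    calc 2 * |γ| / (ω * t ^ 2) ≤ 2 * ((1 + M) / 2) / (m * t ^ 2) := by gcongr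
      _ = _ := by field_simp

/-- A locally uniform integrable bound for the integrand. -/
theorem exists_bound_sineKernel {m M δ : ℝ} (hm : 0 < m) (hδ : 0 < δ) :
    ∃ b : ℝ → ℝ, IntegrableOn b (Ioi 0) ∧ ∀ ω ∈ Icc m M, ∀ z ∈ Icc δ (1 + ω - δ),
      ∀ t, 0 < t → |sineKernel ω z t| ≤ b t := by
  set K := 2 * ((1 + M) / 2) ^ 3 * Real.exp ((1 + M) / 2) / m +
      2 * ((1 + M) / 2) * Real.exp ((1 + M) / 2) * (Real.exp 1 / 4) / m +
      2 * ((1 + M) / 2) * Real.exp ((1 + M) / 2) * (M * Real.exp M / 4)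
  set f : ℝ → ℝ := fun t => 1 / ((1 - Real.exp (-1)) * (1 - Real.exp (-m))) * Real.exp (-δ * t) +
      (1 + M) / m * t ^ (-2 : ℝ)
  refine ⟨(Iic 1).piecewise (fun _ => K) f, ?_, ?_⟩
  · rw [← Ioc_union_Ioi_eq_Ioi zero_le_one]
    refine IntegrableOn.union ?_ ?_
    · refine (integrableOn_const (C := K) (by simp)).congr_fun ?_ measurableSet_Ioc
      intro t ht
      rw [piecewise_eq_of_mem _ _ _ (show t ∈ Iic 1 from ht.2)]
    · refine IntegrableOn.congr_fun (f := f) ?_ ?_ measurableSet_Ioi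
      · refine Integrable.add (Integrable.const_mul ?_ _) (Integrable.const_mul ?_ _)
        · exact exp_neg_integrableOn_Ioi 1 hδ
        · exact integrableOn_Ioi_rpow_of_lt (by norm_num) one_pos
      · intro t ht
        rw [piecewise_eq_of_notMem _ _ _ (notMem_Iic.2 ht)]
  · intro ω hω z hz t ht
    have h1 : |z - (1 + ω) / 2| ≤ (1 + ω) / 2 - δ := by
      rw [abs_le]; constructor <;> linarith [hz.1, hz.2]
    have h2 : |z - (1 + ω) / 2| ≤ (1 + M) / 2 := h1.trans (by linarith [hω.2])
    by_cases h : t ≤ 1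
    · rw [piecewise_eq_of_mem _ _ _ (show t ∈ Iic 1 from h)]
      exact abs_sineKernel_le_of_le_one hm hω h2 ht h
    · rw [piecewise_eq_of_notMem _ _ _ (notMem_Iic.2 (not_le.1 h))]
      exact abs_sineKernel_le_of_one_le hm hω h1 h2 (not_le.1 h).le

theorem continuousOn_sineKernel {ω : ℝ} (hω : 0 < ω) (z : ℝ) :
    ContinuousOn (sineKernel ω z) (Ioi 0) := by
  unfold sineKernel
  have h1 : ∀ t ∈ Ioi (0 : ℝ), 2 * Real.sinh (t / 2) * Real.sinh (ω * t / 2) ≠ 0 := fun t ht =>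
    (mul_pos (mul_pos two_pos (sinh_half_pos ht)) (sinh_half_pos (mul_pos hω ht))).ne'
  have h2 : ∀ t ∈ Ioi (0 : ℝ), ω * t ≠ 0 := fun t ht => (mul_pos hω ht).ne'
  have h3 : ∀ t ∈ Ioi (0 : ℝ), t ≠ 0 := fun t ht => ne_of_gt ht
  have c1 : Continuous fun t => Real.sinh ((z - (1 + ω) / 2) * t) :=
    Real.continuous_sinh.comp (by fun_prop)
  have c2 : Continuous fun t => 2 * Real.sinh (t / 2) * Real.sinh (ω * t / 2) :=
    (continuous_const.mul (Real.continuous_sinh.comp (by fun_prop))).mul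
      (Real.continuous_sinh.comp (by fun_prop))
  exact ((c1.continuousOn.div c2.continuousOn h1).sub
    (continuousOn_const.div (by fun_prop) h2)).div continuousOn_id h3

theorem integrableOn_sineKernel {ω z : ℝ} (hω : 0 < ω) (hz : 0 < z) (hz' : z < 1 + ω) :
    IntegrableOn (sineKernel ω z) (Ioi 0) := by
  obtain ⟨b, hb, h⟩ := exists_bound_sineKernel (M := ω) (δ := min z (1 + ω - z)) hω
    (lt_min hz (by linarith))
  refine Integrable.mono' hb
    ((continuousOn_sineKernel hω z).aestronglyMeasurable measurableSet_Ioi) ?_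
  refine (ae_restrict_mem measurableSet_Ioi).mono fun t ht => ?_
  rw [Real.norm_eq_abs]
  exact h ω ⟨le_rfl, le_rfl⟩ z ⟨min_le_left _ _, by linarith [min_le_right z (1 + ω - z)]⟩ t ht

theorem exists_bound_logSine {m M δ : ℝ} (hm : 0 < m) (hδ : 0 < δ) :
    ∃ B : ℝ, ∀ ω ∈ Icc m M, ∀ z ∈ Icc δ (1 + ω - δ), |logSine ω z| ≤ B := by
  obtain ⟨b, hb, h⟩ := exists_bound_sineKernel (M := M) hm hδ
  refine ⟨∫ t in Ioi 0, b t, fun ω hω z hz => ?_⟩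
  rw [← Real.norm_eq_abs]
  refine norm_integral_le_of_norm_le hb ?_
  refine (ae_restrict_mem measurableSet_Ioi).mono fun t ht => ?_
  exact h ω hω z hz t ht

/-- Dominated convergence; it is applied with rational periods tending to the unit. Shrinking `δ`
and the range of periods keeps the moving pair in the region of one integrable bound. -/
theorem tendsto_logSine {ι : Type*} {l : Filter ι} [l.IsCountablyGenerated] {ω z : ι → ℝ}
    {ω₀ z₀ : ℝ} (hω : Tendsto ω l (𝓝 ω₀)) (hz : Tendsto z l (𝓝 z₀)) (hω₀ : 0 < ω₀) (hz₀ : 0 < z₀)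
    (hz₀' : z₀ < 1 + ω₀) :
    Tendsto (fun i => logSine (ω i) (z i)) l (𝓝 (logSine ω₀ z₀)) := by
  set δ := min (z₀ / 2) ((1 + ω₀ - z₀) / 2) with hδ
  have hδ0 : 0 < δ := lt_min (by linarith) (by linarith)
  have hδ1 : δ < z₀ := (min_le_left _ _).trans_lt (by linarith)
  have hδ2 : δ < 1 + ω₀ - z₀ := (min_le_right _ _).trans_lt (by linarith)
  obtain ⟨b, hb, h⟩ := exists_bound_sineKernel (m := ω₀ / 2) (M := ω₀ + 1) (half_pos hω₀) hδ0
  have e1 : ∀ᶠ i in l, ω i ∈ Icc (ω₀ / 2) (ω₀ + 1) :=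
    hω.eventually (Icc_mem_nhds (by linarith) (by linarith))
  have e2 : ∀ᶠ i in l, z i ∈ Icc δ (1 + ω i - δ) := by
    have ha : ∀ᶠ i in l, δ < z i := hz.eventually (lt_mem_nhds hδ1)
    have hb : ∀ᶠ i in l, δ < 1 + ω i - z i :=
      ((hω.const_add 1).sub hz).eventually (lt_mem_nhds hδ2)
    filter_upwards [ha, hb] with i h1 h2 using ⟨h1.le, by linarith⟩
  refine tendsto_integral_filter_of_dominated_convergence b ?_ ?_ hb ?_
  · filter_upwards [e1] with i hi
    exact (continuousOn_sineKernel (lt_of_lt_of_le (half_pos hω₀) hi.1) _).aestronglyMeasurable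
      measurableSet_Ioi
  · filter_upwards [e1, e2] with i h1 h2
    exact (ae_restrict_mem measurableSet_Ioi).mono fun t ht => h _ h1 _ h2 t ht
  · refine (ae_restrict_mem measurableSet_Ioi).mono fun t (ht : 0 < t) => ?_
    have h1 := (sinh_half_pos ht).ne'
    have h2 := (sinh_half_pos (mul_pos hω₀ ht)).ne'
    have h3 := (mul_pos hω₀ ht).ne'
    unfold sineKernel
    refine Tendsto.div_const (Tendsto.sub (Tendsto.div ?_ ?_ (by positivity))
      (Tendsto.div ?_ ?_ h3)) t
    · exact (Real.continuous_sinh.tendsto _).comp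
        ((hz.sub ((hω.const_add 1).div_const 2)).mul_const t)
    · exact Tendsto.const_mul _ ((Real.continuous_sinh.tendsto _).comp
        ((hω.mul_const t).div_const 2))
    · exact (((hz.const_mul 2).sub_const 1).sub hω)
    · exact hω.mul_const t

/-! ### Symmetries -/

theorem logSine_reflect (ω z : ℝ) : logSine ω (1 + ω - z) = -logSine ω z := by
  rw [logSine, logSine, ← integral_neg]
  refine integral_congr_ae (Eventually.of_forall fun t => ?_)
  simp only [sineKernel]
  rw [show (1 + ω - z - (1 + ω) / 2) * t = -((z - (1 + ω) / 2) * t) by ring, Real.sinh_neg]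
  ring

theorem integral_Ioi_comp_mul {c : ℝ} (hc : 0 < c) (f : ℝ → ℝ) :
    ∫ t in Ioi 0, c * f (c * t) = ∫ t in Ioi 0, f t := by
  rw [integral_const_mul, integral_comp_mul_left_Ioi f 0 hc, mul_zero, smul_eq_mul,
    mul_inv_cancel_left₀ hc.ne']

/-- Homogeneity: rescaling the integration variable by `ω` exchanges the two hyperbolic sines in the
denominator. -/
theorem logSine_inv {ω : ℝ} (hω : 0 < ω) (z : ℝ) : logSine ω⁻¹ (z / ω) = logSine ω z := by
  rw [logSine, logSine, ← integral_Ioi_comp_mul hω]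
  refine setIntegral_congr_fun measurableSet_Ioi fun t (ht : 0 < t) => ?_
  simp only [sineKernel]
  rw [show ω⁻¹ * (ω * t) / 2 = t / 2 by field_simp,
    show (z / ω - (1 + ω⁻¹) / 2) * (ω * t) = (z - (1 + ω) / 2) * t by field_simp; ring]
  have h1 := (sinh_half_pos ht).ne'
  have h2 := (sinh_half_pos (mul_pos hω ht)).ne'
  field_simp
  ring

/-- The product-to-sum formula makes the left side a telescoping sum of hyperbolic cosines. -/
theorem sum_sinh (A B : ℝ) (q : ℕ) :
    Real.sinh (B / 2) * ∑ r ∈ Finset.range q, Real.sinh (A + r * B) =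
      Real.sinh (A + (q - 1) * B / 2) * Real.sinh (q * B / 2) := by
  have prod (x y : ℝ) : Real.sinh x * Real.sinh y = (Real.cosh (x + y) - Real.cosh (x - y)) / 2 := by
    rw [Real.cosh_add, Real.cosh_sub]; ring
  rw [prod, Finset.mul_sum]
  have h : ∀ r ∈ Finset.range q, Real.sinh (B / 2) * Real.sinh (A + r * B) =
      Real.cosh (A - B / 2 + ((r + 1 : ℕ) : ℝ) * B) / 2 - Real.cosh (A - B / 2 + (r : ℝ) * B) / 2 := by
    intro r _
    rw [mul_comm, prod]
    push_cast
    ring_nf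
  rw [Finset.sum_congr rfl h, Finset.sum_range_sub fun r : ℕ => Real.cosh (A - B / 2 + r * B) / 2]
  push_cast
  ring_nf

theorem sum_range_cast (q : ℕ) : ∑ r ∈ Finset.range q, (r : ℝ) = q * (q - 1) / 2 := by
  induction q with
  | zero => simp
  | succ n ih => rw [Finset.sum_range_succ, ih]; push_cast; ring

/-- Splitting the multiples of `ω` by residue modulo `q` replaces the period `ω` by `q ω`. On the
integrands this is `sum_sinh`, and the counterterms add up by the arithmetic series. -/
theorem logSine_eq_sum {ω z : ℝ} (hω : 0 < ω) (hz : 0 < z) (hz' : z < 1 + ω) {q : ℕ} (hq : 0 < q) :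
    logSine ω z = ∑ r ∈ Finset.range q, logSine (q * ω) (z + r * ω) := by
  have hq' : (0 : ℝ) < q := by exact_mod_cast hq
  have hqω : 0 < q * ω := by positivity
  unfold logSine
  rw [← integral_finsetSum]
  · refine setIntegral_congr_fun measurableSet_Ioi fun t (ht : 0 < t) => ?_
    simp only [sineKernel]
    have h1 := (sinh_half_pos ht).ne'
    have h2 := (sinh_half_pos (mul_pos hω ht)).ne'
    have h3 := (sinh_half_pos (mul_pos hqω ht)).ne'
    rw [← Finset.sum_div, Finset.sum_sub_distrib, ← Finset.sum_div, ← Finset.sum_div]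
    congr 1
    congr 1
    · have := sum_sinh ((z - (1 + q * ω) / 2) * t) (ω * t) q
      rw [show (z - (1 + q * ω) / 2) * t + (q - 1) * (ω * t) / 2 = (z - (1 + ω) / 2) * t by ring,
        show q * (ω * t) / 2 = q * ω * t / 2 by ring] at this
      have e : ∑ r ∈ Finset.range q, Real.sinh ((z + r * ω - (1 + q * ω) / 2) * t) =
          ∑ r ∈ Finset.range q, Real.sinh ((z - (1 + q * ω) / 2) * t + r * (ω * t)) := by
        refine Finset.sum_congr rfl fun r _ => ?_
        congr 1; ring
      rw [e, div_eq_div_iff (by positivity) (by positivity)]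
      linear_combination (-2 * Real.sinh (t / 2)) * this
    · have : ∑ r ∈ Finset.range q, (2 * (z + r * ω) - 1 - q * ω) =
          q * (2 * z - 1 - q * ω) + 2 * ω * ∑ r ∈ Finset.range q, (r : ℝ) := by
        have e : ∀ r ∈ Finset.range q, 2 * (z + r * ω) - 1 - q * ω =
            (2 * z - 1 - q * ω) + 2 * ω * r := fun r _ => by ring
        rw [Finset.sum_congr rfl e, Finset.sum_add_distrib, Finset.sum_const, Finset.card_range,
          nsmul_eq_mul, ← Finset.mul_sum]
      rw [this, sum_range_cast]
      field_simp
      ring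
  · intro r hr
    have hr' : (r : ℝ) + 1 ≤ q := by exact_mod_cast Finset.mem_range.1 hr
    refine integrableOn_sineKernel hqω (by positivity) ?_
    nlinarith

/-! ### The difference equations -/

/-- `log |2 sin (π w)|`. -/
def logTwoSin (w : ℝ) : ℝ :=
  Real.log |2 * Real.sin (Real.pi * w)|

/-- The integrand of the integral representation of `-log (2 sin (π w))`. -/
def logSinKernel (w t : ℝ) : ℝ :=
  (Real.cosh ((w - 1 / 2) * t) / Real.sinh (t / 2) - 2 / t) / t

/-- The shift by `ω` cancels the factor `sinh (ω t / 2)`, so the difference does not depend on `ω`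
and its integral needs computing only once. -/
theorem sineKernel_add_period {ω t : ℝ} (hω : 0 < ω) (ht : 0 < t) (z : ℝ) :
    sineKernel ω (z + ω) t - sineKernel ω z t = logSinKernel z t := by
  have h1 := (sinh_half_pos ht).ne'
  have h2 := (sinh_half_pos (mul_pos hω ht)).ne'
  have e : Real.sinh ((z + ω - (1 + ω) / 2) * t) - Real.sinh ((z - (1 + ω) / 2) * t) =
      2 * Real.cosh ((z - 1 / 2) * t) * Real.sinh (ω * t / 2) := by
    rw [show (z + ω - (1 + ω) / 2) * t = (z - 1 / 2) * t + ω * t / 2 by ring,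
      show (z - (1 + ω) / 2) * t = (z - 1 / 2) * t - ω * t / 2 by ring,
      Real.sinh_add, Real.sinh_sub]
    ring
  have e' : Real.sinh ((z + ω - (1 + ω) / 2) * t) = Real.sinh ((z - (1 + ω) / 2) * t) +
      2 * Real.cosh ((z - 1 / 2) * t) * Real.sinh (ω * t / 2) := by linarith
  rw [sineKernel, sineKernel, logSinKernel, e']
  field_simp
  ring

theorem integrableOn_logSinKernel {z : ℝ} (hz : 0 < z) (hz' : z < 1) :
    IntegrableOn (logSinKernel z) (Ioi 0) := by
  refine IntegrableOn.congr_fun (f := fun t => sineKernel 1 (z + 1) t - sineKernel 1 z t) ?_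
    (fun t ht => sineKernel_add_period one_pos ht z) measurableSet_Ioi
  exact (integrableOn_sineKernel one_pos (by linarith) (by linarith)).sub
    (integrableOn_sineKernel one_pos hz (by linarith))

theorem logSine_add_period_eq_integral {ω z : ℝ} (hω : 0 < ω) (hz : 0 < z) (hz' : z < 1) :
    logSine ω (z + ω) = logSine ω z + ∫ t in Ioi 0, logSinKernel z t := by
  rw [← sub_eq_iff_eq_add', logSine, logSine, ← integral_sub]
  · exact setIntegral_congr_fun measurableSet_Ioi fun t ht => sineKernel_add_period hω ht z
  · exact integrableOn_sineKernel hω (by linarith) (by linarith)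
  · exact integrableOn_sineKernel hω hz (by linarith)

/-! ### Evaluation of the log-sine integral by Frullani integrals and the product for the sine. -/

theorem integrableOn_inv_mul_exp_sub_exp {a b : ℝ} (ha : 0 < a) (hb : 0 < b) :
    IntegrableOn (fun x : ℝ => x⁻¹ • (Real.exp (-(a * x)) - Real.exp (-(b * x)))) (Ioi 0) := by
  wlog hab : a ≤ b generalizing a b
  · refine (this hb ha (le_of_not_ge hab)).neg.congr_fun (fun x _ => ?_) measurableSet_Ioi
    simp only [Pi.neg_apply, smul_eq_mul]
    ring
  refine Integrable.mono' (g := fun x => (b - a) * Real.exp (-a * x))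
    ((exp_neg_integrableOn_Ioi 0 ha).const_mul _) ?_ ?_
  · refine ContinuousOn.aestronglyMeasurable (fun x hx => ?_) measurableSet_Ioi
    have hx0 : x ≠ 0 := ne_of_gt hx
    exact ContinuousAt.continuousWithinAt (by fun_prop (disch := assumption))
  · refine (ae_restrict_mem measurableSet_Ioi).mono fun x (hx : 0 < x) => ?_
    have h1 : Real.exp (-(b * x)) = Real.exp (-(a * x)) * Real.exp (-((b - a) * x)) := by
      rw [← Real.exp_add]; ring_nf
    have h2 := Real.add_one_le_exp (-((b - a) * x))
    have h3 : Real.exp (-((b - a) * x)) ≤ 1 := by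
      rw [Real.exp_le_one_iff]; nlinarith
    have h4 := Real.exp_pos (-(a * x))
    rw [h1, smul_eq_mul, Real.norm_eq_abs, abs_of_nonneg, inv_mul_le_iff₀ hx,
      show -a * x = -(a * x) by ring]
    · nlinarith
    · refine mul_nonneg (inv_nonneg.2 hx.le) ?_
      nlinarith

theorem integral_inv_mul_exp_sub_exp {a b : ℝ} (ha : 0 < a) (hb : 0 < b) :
    ∫ x in Ioi 0, x⁻¹ • (Real.exp (-(a * x)) - Real.exp (-(b * x))) =
      Real.log b - Real.log a := by
  have h := Frullani.integral_Ioi_eq (f := fun x : ℝ => Real.exp (-x)) (L := 1) (R := 0) ?_ ha hb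
    ?_ ?_ (integrableOn_inv_mul_exp_sub_exp ha hb)
  · rw [h, Real.log_div hb.ne' ha.ne']; simp
  · exact (by fun_prop : Continuous fun x : ℝ => Real.exp (-x)).locallyIntegrable.locallyIntegrableOn _
  · have : Tendsto (fun x : ℝ => Real.exp (-x)) (𝓝 0) (𝓝 (Real.exp (-0))) :=
      (by fun_prop : Continuous fun x : ℝ => Real.exp (-x)).tendsto 0
    rw [neg_zero, Real.exp_zero] at this
    exact this.mono_left nhdsWithin_le_nhds
  · exact Real.tendsto_exp_neg_atTop_nhds_zero

/-- The terms of the logarithm of the infinite product of `1 / sin (π w)`. -/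
def logSinTerm (w : ℝ) (n : ℕ) : ℝ :=
  (Real.log (1 / 2 + n) - Real.log (w + n)) + (Real.log (1 / 2 + n) - Real.log (1 - w + n))

/-- Arithmetic-geometric mean: `w + n` and `1 - w + n` have mean `1 / 2 + n`. Positivity reduces
summability to convergence of partial sums. -/
theorem logSinTerm_nonneg {w : ℝ} (hw : 0 < w) (hw' : w < 1) (n : ℕ) : 0 ≤ logSinTerm w n := by
  have hn : (0 : ℝ) ≤ n := n.cast_nonneg
  have h : Real.log ((w + n) * (1 - w + n)) ≤ Real.log ((1 / 2 + n) * (1 / 2 + n)) := by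
    apply Real.log_le_log
    · apply mul_pos <;> linarith
    · nlinarith [sq_nonneg (w - 1 / 2)]
  rw [Real.log_mul (by linarith) (by linarith), Real.log_mul (by linarith) (by linarith)] at h
  rw [logSinTerm]
  linarith

/-- The partial sums are combinations of Gauss's sequences for `log Γ` at `w`, `1 - w` and `1 / 2`;
the reflection formula evaluates the limit. -/
theorem hasSum_logSinTerm {w : ℝ} (hw : 0 < w) (hw' : w < 1) :
    HasSum (logSinTerm w) (-Real.log (Real.sin (Real.pi * w))) := by
  rw [hasSum_iff_tendsto_nat_of_nonneg (logSinTerm_nonneg hw hw'), ← tendsto_add_atTop_iff_nat 1]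
  have h := ((Real.BohrMollerup.tendsto_log_gamma hw).add
    (Real.BohrMollerup.tendsto_log_gamma (sub_pos.2 hw'))).sub
    ((Real.BohrMollerup.tendsto_log_gamma (show (0 : ℝ) < 1 / 2 by norm_num)).const_mul 2)
  convert h using 1
  · funext n
    simp only [logSinTerm, Real.BohrMollerup.logGammaSeq, Finset.sum_add_distrib,
      Finset.sum_sub_distrib]
    ring
  · have hs : 0 < Real.sin (Real.pi * w) :=
      Real.sin_pos_of_pos_of_lt_pi (by positivity) (by nlinarith [Real.pi_pos])
    rw [← Real.log_mul (Real.Gamma_pos_of_pos hw).ne' (Real.Gamma_pos_of_pos (sub_pos.2 hw')).ne',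
      Real.Gamma_mul_Gamma_one_sub, Real.Gamma_one_half_eq, Real.log_sqrt Real.pi_pos.le,
      Real.log_div Real.pi_ne_zero hs.ne']
    ring_nf

theorem hasSum_exp_eq_inv_sinh {t : ℝ} (ht : 0 < t) :
    HasSum (fun n : ℕ => Real.exp (-((1 / 2 + n) * t))) (1 / (2 * Real.sinh (t / 2))) := by
  have h0 : Real.exp (-t) < 1 := Real.exp_lt_one_iff.2 (by linarith)
  have h := (hasSum_geometric_of_lt_one (Real.exp_pos (-t)).le h0).mul_left (Real.exp (-(t / 2)))
  have e1 : (fun n : ℕ => Real.exp (-((1 / 2 + n) * t))) =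
      fun n : ℕ => Real.exp (-(t / 2)) * Real.exp (-t) ^ n := by
    funext n
    rw [← Real.exp_nat_mul, ← Real.exp_add]
    congr 1
    ring
  have e2 : 1 / (2 * Real.sinh (t / 2)) = Real.exp (-(t / 2)) * (1 - Real.exp (-t))⁻¹ := by
    have h1 : Real.exp (-t) = Real.exp (-(t / 2)) * Real.exp (-(t / 2)) := by
      rw [← Real.exp_add]; congr 1; ring
    have h2 : Real.exp (t / 2) * Real.exp (-(t / 2)) = 1 := by
      rw [← Real.exp_add]; simp
    have h5 : 1 - Real.exp (-t) ≠ 0 := by linarith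
    have h6 := sinh_half_pos ht
    rw [← div_eq_mul_inv, div_eq_div_iff (by positivity) h5, Real.sinh_eq, h1]
    linear_combination -h2
  rw [e1, e2]
  exact h

/-- Subtracting the value at `1 / 2` removes the counterterm. Expanding `1 / sinh` geometrically
gives Frullani integrals, which may be summed because the terms are nonnegative (`cosh ≥ 1`), so
their `L¹` norms are the summable `logSinTerm`. -/
theorem integral_logSinKernel_sub {w : ℝ} (hw : 0 < w) (hw' : w < 1) :
    (∫ t in Ioi 0, logSinKernel w t) - ∫ t in Ioi 0, logSinKernel (1 / 2) t =
      -Real.log (Real.sin (Real.pi * w)) := by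
  set F : ℕ → ℝ → ℝ := fun n t =>
    t⁻¹ • (Real.exp (-((w + n) * t)) - Real.exp (-((1 / 2 + n) * t))) +
      t⁻¹ • (Real.exp (-((1 - w + n) * t)) - Real.exp (-((1 / 2 + n) * t))) with hF
  have p1 (n : ℕ) : 0 < w + n := by positivity
  have p2 (n : ℕ) : 0 < 1 - w + n := by have : (0 : ℝ) ≤ n := n.cast_nonneg; linarith
  have p3 (n : ℕ) : 0 < (1 / 2 : ℝ) + n := by positivity
  have hint (n : ℕ) : IntegrableOn (F n) (Ioi 0) :=
    (integrableOn_inv_mul_exp_sub_exp (p1 n) (p3 n)).add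
      (integrableOn_inv_mul_exp_sub_exp (p2 n) (p3 n))
  have hval (n : ℕ) : ∫ t in Ioi 0, F n t = logSinTerm w n := by
    rw [hF, integral_add (integrableOn_inv_mul_exp_sub_exp (p1 n) (p3 n))
      (integrableOn_inv_mul_exp_sub_exp (p2 n) (p3 n)),
      integral_inv_mul_exp_sub_exp (p1 n) (p3 n), integral_inv_mul_exp_sub_exp (p2 n) (p3 n),
      logSinTerm]
  have hFeq (n : ℕ) (t : ℝ) : F n t =
      t⁻¹ * (2 * (Real.cosh ((w - 1 / 2) * t) - 1)) * Real.exp (-((1 / 2 + n) * t)) := by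
    have e1 : Real.exp (-((w + n) * t)) =
        Real.exp (-((1 / 2 + n) * t)) * Real.exp (-((w - 1 / 2) * t)) := by
      rw [← Real.exp_add]; ring_nf
    have e2 : Real.exp (-((1 - w + n) * t)) =
        Real.exp (-((1 / 2 + n) * t)) * Real.exp ((w - 1 / 2) * t) := by
      rw [← Real.exp_add]; ring_nf
    simp only [hF, smul_eq_mul]
    rw [e1, e2, Real.cosh_eq]
    ring
  have hnorm (n : ℕ) : ∫ t in Ioi 0, ‖F n t‖ = logSinTerm w n := by
    rw [← hval]
    refine setIntegral_congr_fun measurableSet_Ioi fun t (ht : 0 < t) => ?_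
    rw [Real.norm_eq_abs, abs_of_nonneg]
    rw [hFeq]
    have := Real.one_le_cosh ((w - 1 / 2) * t)
    have : 0 ≤ Real.cosh ((w - 1 / 2) * t) - 1 := by linarith
    positivity
  have hs := hasSum_logSinTerm hw hw'
  have := hasSum_integral_of_summable_integral_norm hint (by simp_rw [hnorm]; exact hs.summable)
  simp_rw [hval] at this
  rw [← this.unique hs, ← integral_sub (integrableOn_logSinKernel hw hw')
    (integrableOn_logSinKernel (by norm_num) (by norm_num))]
  refine setIntegral_congr_fun measurableSet_Ioi fun t (ht : 0 < t) => ?_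
  simp only [hFeq, tsum_mul_left, (hasSum_exp_eq_inv_sinh ht).tsum_eq, logSinKernel]
  have := (sinh_half_pos ht).ne'
  simp only [sub_self, zero_mul, Real.cosh_zero]
  field_simp
  ring

/-- Halving the variable and the duplication formula for `sinh` give `I(1/2) = 2 I(1/4)`, while the
previous lemma gives `I(1/4) = I(1/2) + (log 2) / 2`. The two equations determine `I(1/2)`. -/
theorem integral_logSinKernel_half :
    ∫ t in Ioi 0, logSinKernel (1 / 2) t = -Real.log 2 := by
  have h : ∫ t in Ioi 0, logSinKernel (1 / 2) t = ∫ t in Ioi 0, 2 * logSinKernel (1 / 4) t := by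
    rw [← integral_Ioi_comp_mul (show (0 : ℝ) < 1 / 2 by norm_num)]
    refine setIntegral_congr_fun measurableSet_Ioi fun t (ht : 0 < t) => ?_
    simp only [logSinKernel, sub_self, zero_mul, Real.cosh_zero]
    have h1 := (sinh_half_pos (half_pos ht)).ne'
    have h2 := (Real.cosh_pos (t / 2 / 2)).ne'
    rw [show (1 / 4 - 1 / 2) * t = -(t / 2 / 2) by ring, Real.cosh_neg,
      show 1 / 2 * t / 2 = t / 2 / 2 by ring,
      show Real.sinh (t / 2) = 2 * Real.sinh (t / 2 / 2) * Real.cosh (t / 2 / 2) by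
        rw [← Real.sinh_two_mul]; ring_nf]
    field_simp
  rw [integral_const_mul] at h
  have h2 := integral_logSinKernel_sub (w := 1 / 4) (by norm_num) (by norm_num)
  rw [show Real.pi * (1 / 4) = Real.pi / 4 by ring, Real.sin_pi_div_four,
    Real.log_div (by positivity) two_ne_zero, Real.log_sqrt (by norm_num)] at h2
  linarith

theorem integral_logSinKernel {w : ℝ} (hw : 0 < w) (hw' : w < 1) :
    ∫ t in Ioi 0, logSinKernel w t = -logTwoSin w := by
  have hs : 0 < Real.sin (Real.pi * w) :=
    Real.sin_pos_of_pos_of_lt_pi (by positivity) (by nlinarith [Real.pi_pos])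
  have h := integral_logSinKernel_sub hw hw'
  rw [integral_logSinKernel_half] at h
  rw [logTwoSin, abs_of_pos (by positivity), Real.log_mul two_ne_zero hs.ne']
  linarith

theorem logSine_add_period {ω z : ℝ} (hω : 0 < ω) (hz : 0 < z) (hz' : z < 1) :
    logSine ω (z + ω) = logSine ω z - logTwoSin z := by
  rw [logSine_add_period_eq_integral hω hz hz', integral_logSinKernel hz hz', sub_eq_add_neg]

theorem logSine_add_one {ω z : ℝ} (hω : 0 < ω) (hz : 0 < z) (hz' : z < ω) :
    logSine ω (z + 1) = logSine ω z - logTwoSin (z / ω) := by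
  rw [← logSine_inv hω z, ← logSine_inv hω (z + 1), add_div, one_div,
    logSine_add_period (inv_pos.2 hω) (div_pos hz hω) ((div_lt_one hω).2 hz')]

/-! ### The Barnes double zeta function as a Mellin transform -/

/-- The generating function `∑ exp (-(z + m + n ω) t)` of the Barnes double zeta function. -/
def barnesKernel (ω z t : ℝ) : ℝ :=
  Real.exp (-((z - (1 + ω) / 2) * t)) * (1 / (2 * Real.sinh (t / 2))) *
    (1 / (2 * Real.sinh (ω * t / 2)))

/-- The coefficient of `exp (-t) / t` in the expansion of `barnesKernel` at `0`. -/
def barnesCoeffOne (ω z : ℝ) : ℝ :=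
  (1 - (z - (1 + ω) / 2)) / ω

/-- The coefficient of `exp (-t)` in the expansion of `barnesKernel` at `0`. -/
def barnesCoeffZero (ω z : ℝ) : ℝ :=
  ((1 - (z - (1 + ω) / 2)) ^ 2 / 2 - (1 + ω ^ 2) / 24) / ω

/-- `barnesKernel` without its polar part at `0`. -/
def barnesRemainder (ω z t : ℝ) : ℝ :=
  barnesKernel ω z t -
    Real.exp (-t) * (1 / ω / t ^ 2 + barnesCoeffOne ω z / t + barnesCoeffZero ω z)

theorem hasSum_barnesKernel {ω : ℝ} (hω : 0 < ω) (z : ℝ) {t : ℝ} (ht : 0 < t) :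
    HasSum (fun p : ℕ × ℕ => Real.exp (-(z + p.1 + p.2 * ω) * t)) (barnesKernel ω z t) := by
  have h1 := hasSum_exp_eq_inv_sinh ht
  have h2 := hasSum_exp_eq_inv_sinh (mul_pos hω ht)
  have h3 := (h1.mul h2 (h1.summable.mul_of_nonneg h2.summable (fun n => (Real.exp_pos _).le)
    (fun n => (Real.exp_pos _).le))).mul_left (Real.exp (-((z - (1 + ω) / 2) * t)))
  rw [← mul_assoc] at h3
  have e : (fun p : ℕ × ℕ => Real.exp (-(z + p.1 + p.2 * ω) * t)) = fun p : ℕ × ℕ =>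
      Real.exp (-((z - (1 + ω) / 2) * t)) *
      (Real.exp (-((1 / 2 + p.1) * t)) * Real.exp (-((1 / 2 + p.2) * (ω * t)))) := by
    funext p
    rw [← Real.exp_add, ← Real.exp_add]
    congr 1
    ring
  rw [e]
  exact h3

theorem summable_one_div_barnes {ω z σ : ℝ} (hω : 0 < ω) (hz : 0 < z) (hσ : 2 < σ) :
    Summable fun p : ℕ × ℕ => 1 / (z + p.1 + p.2 * ω) ^ σ := by
  -- With this `c` one has `c ((m + 1) + (n + 1)) ≤ z + m + n ω`. Bounding `√((m + 1)(n + 1))` by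
  -- the sum then splits the double series into two series with exponent `σ / 2 > 1`.
  set c := min (z / 2) (min 1 ω) with hc
  have hc0 : 0 < c := lt_min (half_pos hz) (lt_min one_pos hω)
  have hc1 : c ≤ z / 2 := min_le_left _ _
  have hc2 : c ≤ 1 := (min_le_right _ _).trans (min_le_left _ _)
  have hc3 : c ≤ ω := (min_le_right _ _).trans (min_le_right _ _)
  have hs : Summable fun n : ℕ => 1 / |(n : ℝ) + 1| ^ (σ / 2) :=
    (Real.summable_one_div_nat_add_rpow 1 (σ / 2)).2 (by linarith)
  have hs2 := (hs.mul_of_nonneg hs (fun n => by positivity) (fun n => by positivity)).mul_left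
    (1 / c ^ σ)
  refine Summable.of_nonneg_of_le (fun p => by positivity) (fun p => ?_) hs2
  obtain ⟨m, n⟩ := p
  have hm : (0 : ℝ) ≤ m := m.cast_nonneg
  have hn : (0 : ℝ) ≤ n := n.cast_nonneg
  simp only
  rw [abs_of_pos (by positivity), abs_of_pos (by positivity), one_div_mul_one_div,
    one_div_mul_one_div, ← Real.mul_rpow (by positivity) (by positivity)]
  apply one_div_le_one_div_of_le (by positivity)
  have e : (((m : ℝ) + 1) * (n + 1)) ^ (σ / 2) = Real.sqrt (((m : ℝ) + 1) * (n + 1)) ^ σ := by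
    rw [Real.sqrt_eq_rpow, ← Real.rpow_mul (by positivity)]
    congr 1
    ring
  rw [e, ← Real.mul_rpow hc0.le (Real.sqrt_nonneg _)]
  refine Real.rpow_le_rpow (by positivity) ?_ (by linarith)
  have h1 : Real.sqrt (((m : ℝ) + 1) * (n + 1)) ≤ (m + 1) + (n + 1) := by
    rw [Real.sqrt_le_left (by positivity)]
    nlinarith
  calc c * Real.sqrt (((m : ℝ) + 1) * (n + 1)) ≤ c * ((m + 1) + (n + 1)) := by gcongr
    _ ≤ _ := by nlinarith

/-! #### Expansion at zero -/

/-- `f = 1 + a t + b t² + O(t³)` as `t → 0+`. -/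
def HasExpansion (f : ℝ → ℝ) (a b : ℝ) : Prop :=
  (fun t => f t - (1 + a * t + b * t ^ 2)) =O[𝓝[>] 0] fun t => t ^ 3

theorem HasExpansion.isBigO_one {f : ℝ → ℝ} {a b : ℝ} (hf : HasExpansion f a b) :
    f =O[𝓝[>] 0] fun _ => (1 : ℝ) := by
  have h1 : (fun t : ℝ => t ^ 3) =O[𝓝[>] 0] fun _ => (1 : ℝ) :=
    (((continuous_id.pow 3).tendsto (0 : ℝ)).mono_left nhdsWithin_le_nhds).isBigO_one ℝ
  have h2 : (fun t : ℝ => 1 + a * t + b * t ^ 2) =O[𝓝[>] 0] fun _ => (1 : ℝ) :=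
    (((by fun_prop : Continuous fun t : ℝ => 1 + a * t + b * t ^ 2).tendsto (0 : ℝ)).mono_left
      nhdsWithin_le_nhds).isBigO_one ℝ
  simpa using (Asymptotics.IsBigO.trans hf h1).add h2

theorem HasExpansion.mul {f g : ℝ → ℝ} {a b a' b' : ℝ} (hf : HasExpansion f a b)
    (hg : HasExpansion g a' b') :
    HasExpansion (fun t => f t * g t) (a + a') (b + a * a' + b') := by
  have h1 : (fun t => (f t - (1 + a * t + b * t ^ 2)) * g t) =O[𝓝[>] 0] fun t => t ^ 3 := by
    simpa using Asymptotics.IsBigO.mul hf hg.isBigO_one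
  have h2 : (fun t => (1 + a * t + b * t ^ 2) * (g t - (1 + a' * t + b' * t ^ 2))) =O[𝓝[>] 0]
      fun t => t ^ 3 := by
    have : (fun t : ℝ => 1 + a * t + b * t ^ 2) =O[𝓝[>] 0] fun _ => (1 : ℝ) :=
      (((by fun_prop : Continuous fun t : ℝ => 1 + a * t + b * t ^ 2).tendsto (0 : ℝ)).mono_left
        nhdsWithin_le_nhds).isBigO_one ℝ
    simpa using this.mul hg
  have h3 : (fun t : ℝ => t ^ 3 * (a * b' + b * a' + b * b' * t)) =O[𝓝[>] 0] fun t => t ^ 3 := by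
    have : (fun t : ℝ => a * b' + b * a' + b * b' * t) =O[𝓝[>] 0] fun _ => (1 : ℝ) :=
      (((by fun_prop : Continuous fun t : ℝ => a * b' + b * a' + b * b' * t).tendsto
        (0 : ℝ)).mono_left nhdsWithin_le_nhds).isBigO_one ℝ
    simpa using (Asymptotics.isBigO_refl (fun t : ℝ => t ^ 3) (𝓝[>] 0)).mul this
  refine ((h1.add h2).add h3).congr_left fun t => ?_
  ring

theorem hasExpansion_exp (c : ℝ) : HasExpansion (fun t => Real.exp (c * t)) c (c ^ 2 / 2) := by
  have h := (Real.exp_sub_sum_range_isBigO_pow 3).comp_tendsto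
    (((continuous_const.mul continuous_id).tendsto' (0 : ℝ) 0 (by simp) :
      Tendsto (fun t : ℝ => c * t) (𝓝 0) (𝓝 0)).mono_left (nhdsWithin_le_nhds (s := Ioi 0)))
  have h2 : ((fun x : ℝ => x ^ 3) ∘ fun t : ℝ => c * t) =O[𝓝[>] 0] fun t => t ^ 3 := by
    refine ((Asymptotics.isBigO_refl (fun t : ℝ => t ^ 3) (𝓝[>] 0)).const_mul_left
      (c ^ 3)).congr_left fun t => ?_
    simp only [Function.comp]
    ring
  refine (h.trans h2).congr_left fun t => ?_
  simp only [Function.comp, Finset.sum_range_succ, Finset.sum_range_zero, Nat.factorial]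
  norm_num
  ring

theorem hasExpansion_sinh : HasExpansion (fun t => 2 * Real.sinh (t / 2) / t) 0 (1 / 24) := by
  refine Asymptotics.IsBigO.of_bound (Real.exp (1 / 2)) ?_
  filter_upwards [Ioo_mem_nhdsGT (show (0 : ℝ) < 1 by norm_num)] with t ht
  obtain ⟨ht0, ht1⟩ := ht
  have h1 := abs_exp_sub_sum_le (t / 2) 4
  have h2 := abs_exp_sub_sum_le (-(t / 2)) 4
  simp only [abs_neg, Finset.sum_range_succ, Finset.sum_range_zero, Nat.factorial] at h1 h2
  rw [abs_of_pos (half_pos ht0)] at h1 h2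
  have h3 : |2 * Real.sinh (t / 2) - t - t ^ 3 / 24| ≤ t ^ 4 * Real.exp (1 / 2) := by
    have he : Real.exp (t / 2) ≤ Real.exp (1 / 2) := Real.exp_le_exp.2 (by linarith)
    have h5 : (t / 2) ^ 4 * Real.exp (t / 2) ≤ t ^ 4 / 16 * Real.exp (1 / 2) := by
      rw [div_pow]; norm_num; gcongr
    have h6 : 0 ≤ t ^ 4 * Real.exp (1 / 2) := by positivity
    have h1' := abs_le.1 (h1.trans h5)
    have h2' := abs_le.1 (h2.trans h5)
    norm_num at h1' h2'
    rw [Real.sinh_eq, abs_le]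
    constructor <;> nlinarith [h1'.1, h1'.2, h2'.1, h2'.2]
  rw [Real.norm_eq_abs, Real.norm_eq_abs, abs_of_pos (by positivity : (0 : ℝ) < t ^ 3)]
  rw [show 2 * Real.sinh (t / 2) / t - (1 + 0 * t + 1 / 24 * t ^ 2) =
    (2 * Real.sinh (t / 2) - t - t ^ 3 / 24) / t by field_simp; ring, abs_div, abs_of_pos ht0,
    div_le_iff₀ ht0]
  linarith

/-- The candidate polynomial times the expansion of `2 sinh (t / 2) / t` is `1 + O(t³)`; multiplying
by the bounded reciprocal gives the claim. -/
theorem hasExpansion_inv_sinh :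
    HasExpansion (fun t => t * (1 / (2 * Real.sinh (t / 2)))) 0 (-1 / 24) := by
  have h0 : HasExpansion (fun t => 1 + 0 * t + (-1 / 24) * t ^ 2) 0 (-1 / 24) := by
    unfold HasExpansion
    simp only [sub_self]
    exact Asymptotics.isBigO_zero _ _
  have h1 := h0.mul hasExpansion_sinh
  have h2 : (fun t : ℝ => t * (1 / (2 * Real.sinh (t / 2)))) =O[𝓝[>] 0] fun _ => (1 : ℝ) := by
    refine Asymptotics.IsBigO.of_bound 1 ?_
    filter_upwards [self_mem_nhdsWithin] with t (ht : 0 < t)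
    have := sinh_half_pos ht
    rw [Real.norm_eq_abs, abs_of_pos (by positivity), norm_one, mul_one]
    calc t * (1 / (2 * Real.sinh (t / 2))) ≤ t * (1 / t) := 
        mul_le_mul_of_nonneg_left (inv_sinh_le ht) ht.le
      _ = 1 := by field_simp
  have h3 := (h2.mul h1).neg_left
  simp only [one_mul] at h3
  refine h3.congr' ?_ EventuallyEq.rfl
  filter_upwards [self_mem_nhdsWithin] with t (ht : 0 < t)
  have := (sinh_half_pos ht).ne'
  field_simp
  ring

theorem HasExpansion.comp_mul {f : ℝ → ℝ} {a b ω : ℝ} (hf : HasExpansion f a b) (hω : 0 < ω) :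
    HasExpansion (fun t => f (ω * t)) (a * ω) (b * ω ^ 2) := by
  have ht : Tendsto (fun t : ℝ => ω * t) (𝓝[>] 0) (𝓝[>] 0) := by
    refine tendsto_nhdsWithin_iff.2 ⟨?_, ?_⟩
    · exact ((continuous_const.mul continuous_id).tendsto' (0 : ℝ) 0 (by simp)).mono_left
        nhdsWithin_le_nhds
    · filter_upwards [self_mem_nhdsWithin] with t ht using mul_pos hω ht
  have h := Asymptotics.IsBigO.comp_tendsto hf ht
  have h2 : ((fun x : ℝ => x ^ 3) ∘ fun t : ℝ => ω * t) =O[𝓝[>] 0] fun t => t ^ 3 := by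
    refine ((Asymptotics.isBigO_refl (fun t : ℝ => t ^ 3) (𝓝[>] 0)).const_mul_left
      (ω ^ 3)).congr_left fun t => ?_
    simp only [Function.comp]
    ring
  refine (h.trans h2).congr_left fun t => ?_
  simp only [Function.comp]
  ring

/-- The factor `exp (-t)` is split off before expanding, whence the constant `c`. The coefficients
in `barnesRemainder` are those of the product of the three second-order expansions, and the cubic
error is divided by `t²`. -/
theorem isBigO_barnesRemainder_zero {ω : ℝ} (hω : 0 < ω) (z : ℝ) :
    barnesRemainder ω z =O[𝓝[>] 0] fun t => t := by
  set c := 1 - (z - (1 + ω) / 2) with hc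
  have h := ((hasExpansion_exp c).mul hasExpansion_inv_sinh).mul
    (hasExpansion_inv_sinh.comp_mul hω)
  have h1 : (fun t : ℝ => Real.exp (-t)) =O[𝓝[>] 0] fun _ => (1 : ℝ) :=
    (((by fun_prop : Continuous fun t : ℝ => Real.exp (-t)).tendsto (0 : ℝ)).mono_left
      nhdsWithin_le_nhds).isBigO_one ℝ
  have h2 := ((h1.mul h).mul (Asymptotics.isBigO_refl (fun t : ℝ => 1 / t ^ 2)
    (𝓝[>] 0))).const_mul_left (1 / ω)
  refine h2.congr' ?_ ?_
  · filter_upwards [self_mem_nhdsWithin] with t (ht : 0 < t)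
    have s1 := (sinh_half_pos ht).ne'
    have s2 := (sinh_half_pos (mul_pos hω ht)).ne'
    have e : Real.exp (-((z - (1 + ω) / 2) * t)) = Real.exp (-t) * Real.exp (c * t) := by
      rw [← Real.exp_add, hc]; congr 1; ring
    rw [barnesRemainder, barnesKernel, barnesCoeffOne, barnesCoeffZero, e, ← hc]
    field_simp
    ring
  · filter_upwards [self_mem_nhdsWithin] with t (ht : 0 < t)
    field_simp

theorem isBigO_barnesRemainder_atTop {ω z : ℝ} (hω : 0 < ω) :
    barnesRemainder ω z =O[atTop] fun t => Real.exp (-(min z 1) * t) := by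
  have e1 : 0 < 1 - Real.exp (-1) := by
    rw [sub_pos, Real.exp_lt_one_iff]; norm_num
  have e2 : 0 < 1 - Real.exp (-ω) := by
    rw [sub_pos, Real.exp_lt_one_iff]; linarith
  refine Asymptotics.IsBigO.of_bound (1 / ((1 - Real.exp (-1)) * (1 - Real.exp (-ω))) +
    (1 / ω + |barnesCoeffOne ω z| + |barnesCoeffZero ω z|)) ?_
  filter_upwards [eventually_ge_atTop 1] with t ht1
  have ht : 0 < t := by linarith
  rw [Real.norm_eq_abs, Real.norm_eq_abs, abs_of_pos (Real.exp_pos _), barnesRemainder, add_mul]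
  refine (abs_sub _ _).trans (add_le_add ?_ ?_)
  · have h1 := exp_mul_le_two_mul_sinh (m := 1) (ω := 1) le_rfl one_pos ht1
    rw [one_mul] at h1
    have h2 := exp_mul_le_two_mul_sinh (le_refl ω) hω ht1
    have s1 := sinh_half_pos ht
    have s2 := sinh_half_pos (mul_pos hω ht)
    rw [barnesKernel, abs_of_pos (by positivity)]
    calc Real.exp (-((z - (1 + ω) / 2) * t)) * (1 / (2 * Real.sinh (t / 2))) *
          (1 / (2 * Real.sinh (ω * t / 2)))
        ≤ Real.exp (-((z - (1 + ω) / 2) * t)) * (1 / (Real.exp (t / 2) * (1 - Real.exp (-1)))) *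
          (1 / (Real.exp (ω * t / 2) * (1 - Real.exp (-ω)))) := by gcongr
      _ = 1 / ((1 - Real.exp (-1)) * (1 - Real.exp (-ω))) * Real.exp (-z * t) := by
        have : Real.exp (-((z - (1 + ω) / 2) * t)) =
            Real.exp (t / 2) * Real.exp (ω * t / 2) * Real.exp (-z * t) := by
          rw [← Real.exp_add, ← Real.exp_add]; congr 1; ring
        rw [this]
        field_simp
      _ ≤ _ := by
        gcongr
        exact min_le_left _ _
  · rw [abs_mul, abs_of_pos (Real.exp_pos _), mul_comm]
    have hexp : Real.exp (-t) ≤ Real.exp (-(min z 1) * t) := by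
      apply Real.exp_le_exp.2
      nlinarith [min_le_right z 1]
    gcongr
    refine (abs_add_le _ _).trans (add_le_add ((abs_add_le _ _).trans (add_le_add ?_ ?_)) le_rfl)
    · rw [abs_of_pos (by positivity)]
      exact div_le_self (by positivity) (one_le_pow₀ ht1)
    · rw [abs_div, abs_of_pos ht]
      exact div_le_self (abs_nonneg _) ht1

theorem continuousOn_barnesKernel {ω : ℝ} (hω : 0 < ω) (z : ℝ) :
    ContinuousOn (barnesKernel ω z) (Ioi 0) := by
  unfold barnesKernel
  have h1 : ∀ t ∈ Ioi (0 : ℝ), 2 * Real.sinh (t / 2) ≠ 0 := fun t ht =>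
    (mul_pos two_pos (sinh_half_pos ht)).ne'
  have h2 : ∀ t ∈ Ioi (0 : ℝ), 2 * Real.sinh (ω * t / 2) ≠ 0 := fun t ht =>
    (mul_pos two_pos (sinh_half_pos (mul_pos hω ht))).ne'
  have c1 : Continuous fun t => 2 * Real.sinh (t / 2) :=
    continuous_const.mul (Real.continuous_sinh.comp (by fun_prop))
  have c2 : Continuous fun t => 2 * Real.sinh (ω * t / 2) :=
    continuous_const.mul (Real.continuous_sinh.comp (by fun_prop))
  exact ((by fun_prop : Continuous fun t : ℝ =>
    Real.exp (-((z - (1 + ω) / 2) * t))).continuousOn.mul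
    (continuousOn_const.div c1.continuousOn h1)).mul (continuousOn_const.div c2.continuousOn h2)

theorem continuousOn_barnesRemainder {ω : ℝ} (hω : 0 < ω) (z : ℝ) :
    ContinuousOn (barnesRemainder ω z) (Ioi 0) := by
  unfold barnesRemainder
  refine (continuousOn_barnesKernel hω z).sub
    ((by fun_prop : Continuous fun t : ℝ => Real.exp (-t)).continuousOn.mul ?_)
  refine ((continuousOn_const.div (by fun_prop) fun t ht => ?_).add
    (continuousOn_const.div continuousOn_id fun t ht => ?_)).add continuousOn_const
  · exact pow_ne_zero 2 (ne_of_gt ht)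
  · exact ne_of_gt ht

/-! #### Meromorphic continuation -/

/-- The Mellin transform of the remainder. -/
def barnesMellin (ω z : ℝ) (s : ℂ) : ℂ :=
  mellin (fun t => (barnesRemainder ω z t : ℂ)) s

theorem locallyIntegrableOn_barnesRemainder {ω : ℝ} (hω : 0 < ω) (z : ℝ) :
    LocallyIntegrableOn (fun t => (barnesRemainder ω z t : ℂ)) (Ioi 0) :=
  (Complex.continuous_ofReal.comp_continuousOn
    (continuousOn_barnesRemainder hω z)).locallyIntegrableOn measurableSet_Ioi

theorem isBigO_ofReal_barnesRemainder_zero {ω : ℝ} (hω : 0 < ω) (z : ℝ) :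
    (fun t => (barnesRemainder ω z t : ℂ)) =O[𝓝[>] 0] fun t => t ^ (-(-1 : ℝ)) := by
  rw [Asymptotics.isBigO_iff]
  obtain ⟨c, hc⟩ := Asymptotics.isBigO_iff.1 (isBigO_barnesRemainder_zero hω z)
  refine ⟨c, hc.mono fun t ht => ?_⟩
  simpa using ht

theorem isBigO_ofReal_barnesRemainder_atTop {ω z : ℝ} (hω : 0 < ω) :
    (fun t => (barnesRemainder ω z t : ℂ)) =O[atTop] fun t => Real.exp (-(min z 1) * t) := by
  rw [Asymptotics.isBigO_iff]
  obtain ⟨c, hc⟩ := Asymptotics.isBigO_iff.1 (isBigO_barnesRemainder_atTop (z := z) hω)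
  refine ⟨c, hc.mono fun t ht => ?_⟩
  rw [Complex.norm_real]
  exact ht

theorem differentiableAt_barnesMellin {ω z : ℝ} (hω : 0 < ω) (hz : 0 < z) {s : ℂ}
    (hs : -1 < s.re) : DifferentiableAt ℂ (barnesMellin ω z) s :=
  mellin_differentiableAt_of_isBigO_rpow_exp (lt_min hz one_pos)
    (locallyIntegrableOn_barnesRemainder hω z) (isBigO_ofReal_barnesRemainder_atTop hω)
    (isBigO_ofReal_barnesRemainder_zero hω z) hs

theorem mellinConvergent_barnesRemainder {ω z : ℝ} (hω : 0 < ω) (hz : 0 < z) {s : ℂ}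
    (hs : -1 < s.re) : MellinConvergent (fun t => (barnesRemainder ω z t : ℂ)) s :=
  mellinConvergent_of_isBigO_rpow_exp (lt_min hz one_pos)
    (locallyIntegrableOn_barnesRemainder hω z) (isBigO_ofReal_barnesRemainder_atTop hω)
    (isBigO_ofReal_barnesRemainder_zero hω z) hs

theorem hasMellin_exp_neg {s : ℂ} (hs : 0 < s.re) :
    HasMellin (fun t : ℝ => (Real.exp (-t) : ℂ)) s (Complex.Gamma s) := by
  refine ⟨?_, ?_⟩
  · refine (Complex.GammaIntegral_convergent hs).congr_fun (fun t _ => ?_) measurableSet_Ioi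
    simp only [smul_eq_mul]
    ring
  · rw [Complex.Gamma_eq_integral hs, Complex.GammaIntegral_eq_mellin]

theorem hasMellin_cpow_mul_exp_neg {s a : ℂ} (hs : 0 < (s + a).re) (c : ℂ) :
    HasMellin (fun t : ℝ => c • ((t : ℂ) ^ a • (Real.exp (-t) : ℂ))) s
      (c * Complex.Gamma (s + a)) := by
  have h := hasMellin_exp_neg hs
  refine ⟨(MellinConvergent.cpow_smul.2 h.1).const_smul c, ?_⟩
  rw [mellin_const_smul, mellin_cpow_smul, h.2, smul_eq_mul]

/-- The polar part carries the factor `exp (-t)`, so its Mellin transform consists of shifted Gamma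
functions. -/
theorem mellin_barnesKernel {ω z : ℝ} (hω : 0 < ω) (hz : 0 < z) {s : ℂ} (hs : 2 < s.re) :
    mellin (fun t => (barnesKernel ω z t : ℂ)) s = barnesMellin ω z s +
      ((1 / ω : ℝ) * Complex.Gamma (s - 2) + barnesCoeffOne ω z * Complex.Gamma (s - 1) +
        barnesCoeffZero ω z * Complex.Gamma s) := by
  have h0 := mellinConvergent_barnesRemainder hω hz (s := s) (by linarith)
  have h1 := hasMellin_cpow_mul_exp_neg (s := s) (a := -2) (by simp; linarith) ((1 / ω : ℝ) : ℂ)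
  have h2 := hasMellin_cpow_mul_exp_neg (s := s) (a := -1) (by simp; linarith)
    (barnesCoeffOne ω z : ℂ)
  have h3 := hasMellin_cpow_mul_exp_neg (s := s) (a := 0) (by simp; linarith)
    (barnesCoeffZero ω z : ℂ)
  have h12 := hasMellin_add h1.1 h2.1
  have h123 := hasMellin_add h12.1 h3.1
  have h := hasMellin_add h0 h123.1
  rw [h123.2, h12.2, h1.2, h2.2, h3.2, add_zero, ← sub_eq_add_neg, ← sub_eq_add_neg] at h
  rw [barnesMellin, ← h.2]
  refine setIntegral_congr_fun measurableSet_Ioi fun t (ht : 0 < t) => ?_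
  simp only
  congr 1
  have ht' : (t : ℂ) ≠ 0 := by exact_mod_cast ht.ne'
  rw [barnesRemainder, Complex.cpow_neg, Complex.cpow_neg, Complex.cpow_zero, Complex.cpow_one,
    Complex.cpow_ofNat]
  push_cast
  simp only [smul_eq_mul]
  field_simp
  ring

/-- The continuation of the Barnes double zeta function. -/
def barnesZeta (ω z : ℝ) (s : ℂ) : ℂ :=
  ((1 / ω : ℝ) : ℂ) / ((s - 1) * (s - 2)) + barnesCoeffOne ω z / (s - 1) + barnesCoeffZero ω z +
    s * ((Complex.Gamma (s + 1))⁻¹ * barnesMellin ω z s)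

theorem isDoubleZeta_barnesZeta {ω z : ℝ} (hω : 0 < ω) (hz : 0 < z) :
    IsDoubleZeta ω z (barnesZeta ω z) := by
  refine ⟨fun s hs => ?_, fun s hs => ?_⟩
  · obtain ⟨h0, h1, h2⟩ := hs
    have h1' := sub_ne_zero.2 h1
    have h2' := sub_ne_zero.2 h2
    refine DifferentiableAt.differentiableWithinAt ?_
    have hG : DifferentiableAt ℂ (fun s : ℂ => (Complex.Gamma (s + 1))⁻¹) s :=
      (Complex.differentiable_one_div_Gamma.comp
        (by fun_prop : Differentiable ℂ fun s : ℂ => s + 1)) s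
    have hM := differentiableAt_barnesMellin hω hz h0
    unfold barnesZeta
    refine DifferentiableAt.add (DifferentiableAt.add (DifferentiableAt.add ?_ ?_) ?_) ?_
    · exact (differentiableAt_const _).div (by fun_prop) (mul_ne_zero h1' h2')
    · exact (differentiableAt_const _).div (by fun_prop) h1'
    · exact differentiableAt_const _
    · exact differentiableAt_id.mul (hG.mul hM)
  · have hs0 : 0 < s.re := by linarith
    have hΓ : Complex.Gamma s ≠ 0 := Complex.Gamma_ne_zero_of_re_pos hs0
    have h := hasSum_mellin (a := fun _ : ℕ × ℕ => (1 : ℂ))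
      (p := fun p : ℕ × ℕ => z + p.1 + p.2 * ω) (F := fun t => (barnesKernel ω z t : ℂ)) (s := s)
      (fun p => Or.inr (by positivity)) hs0 (fun t ht => ?_) ?_
    · rw [mellin_barnesKernel hω hz hs] at h
      have h' := h.mul_left (Complex.Gamma s)⁻¹
      have e1 : s - 1 ≠ 0 := by
        intro h; rw [sub_eq_zero.1 h] at hs; norm_num at hs
      have e2 : s - 2 ≠ 0 := by
        intro h; rw [sub_eq_zero.1 h] at hs; norm_num at hs
      have e0 : s ≠ 0 := by
        intro h; rw [h] at hs; norm_num at hs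
      have g1 : Complex.Gamma s = (s - 1) * Complex.Gamma (s - 1) := by
        rw [← Complex.Gamma_add_one _ e1]; congr 1; ring
      have g2 : Complex.Gamma (s - 1) = (s - 2) * Complex.Gamma (s - 2) := by
        rw [← Complex.Gamma_add_one _ e2]; congr 1; ring
      have g0 : Complex.Gamma (s + 1) = s * Complex.Gamma s := Complex.Gamma_add_one _ e0
      have g3 : Complex.Gamma (s - 2) ≠ 0 :=
        Complex.Gamma_ne_zero_of_re_pos (by simp; linarith)
      convert! h' using 1
      · funext p
        have hp : 0 < z + p.1 + p.2 * ω := by positivity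
        rw [Complex.cpow_neg]
        field_simp
      -- After division by `Γ(s)` the Gamma quotients become rational functions, and `1 / Γ(s)` is
      -- written as `s / Γ(s + 1)`, which is what exhibits the behaviour at `s = 0`.
      · rw [barnesZeta, g0, g1, g2]
        field_simp
        ring
    · have := (Complex.hasSum_ofReal (f := fun p : ℕ × ℕ => Real.exp (-(z + p.1 + p.2 * ω) * t))).2
        (hasSum_barnesKernel hω z ht)
      simpa only [one_mul] using this
    · simpa only [norm_one] using summable_one_div_barnes hω hz hs

/-- The number `3 / 4` is the derivative of `1 / ((s - 1)(s - 2))` at `0`. The last term of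
`barnesZeta` has an explicit factor `s`, so only the value of the Mellin transform at `0`
contributes. -/
theorem hasDerivAt_barnesZeta_zero {ω z : ℝ} (hω : 0 < ω) (hz : 0 < z) :
    HasDerivAt (barnesZeta ω z)
      (((1 / ω * (3 / 4) - barnesCoeffOne ω z + ∫ t in Ioi 0, barnesRemainder ω z t / t : ℝ)) : ℂ)
      0 := by
  have hG : DifferentiableAt ℂ (fun s : ℂ => (Complex.Gamma (s + 1))⁻¹) 0 :=
    (Complex.differentiable_one_div_Gamma.comp
      (by fun_prop : Differentiable ℂ fun s : ℂ => s + 1)) 0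
  have hM := differentiableAt_barnesMellin hω hz (s := 0) (by simp)
  have h4 := (hasDerivAt_id (0 : ℂ)).mul (hG.mul hM).hasDerivAt
  have h1 := (hasDerivAt_const (0 : ℂ) ((1 / ω : ℝ) : ℂ)).div
    (((hasDerivAt_id (0 : ℂ)).sub_const 1).mul ((hasDerivAt_id (0 : ℂ)).sub_const 2)) (by simp)
  have h2 := (hasDerivAt_const (0 : ℂ) (barnesCoeffOne ω z : ℂ)).div
    ((hasDerivAt_id (0 : ℂ)).sub_const 1) (by simp)
  have h := ((h1.add h2).add_const (barnesCoeffZero ω z : ℂ)).add h4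
  have hI : barnesMellin ω z 0 = ((∫ t in Ioi 0, barnesRemainder ω z t / t : ℝ) : ℂ) := by
    rw [barnesMellin, mellin, ← integral_complex_ofReal]
    refine setIntegral_congr_fun measurableSet_Ioi fun t (ht : 0 < t) => ?_
    simp only [zero_sub, Complex.cpow_neg_one, smul_eq_mul]
    push_cast
    ring
  refine h.congr_deriv ?_
  simp only [id, Pi.mul_apply, zero_add, Complex.Gamma_one, hI]
  push_cast
  ring

/-- The domain minus its two poles is not convex, so the identity theorem is applied along three
overlapping convex sets: `Re s > 2`, the part of `Re s > -1` in the upper half plane, and the strip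
`-1 < Re s < 1` containing `0`. -/
theorem IsDoubleZeta.deriv_eq {ω z : ℝ} {F G : ℂ → ℂ} (hF : IsDoubleZeta ω z F)
    (hG : IsDoubleZeta ω z G) : deriv F 0 = deriv G 0 := by
  have ext {U : Set ℂ} (hU : IsOpen U) (hc : Convex ℝ U)
      (hsub : U ⊆ {s : ℂ | -1 < s.re ∧ s ≠ 1 ∧ s ≠ 2}) {s₀ : ℂ} (h₀ : s₀ ∈ U)
      (he : F =ᶠ[𝓝 s₀] G) : EqOn F G U :=
    AnalyticOnNhd.eqOn_of_preconnected_of_eventuallyEq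
      ((hF.1.mono hsub).analyticOnNhd hU) ((hG.1.mono hsub).analyticOnNhd hU)
      hc.isPreconnected h₀ he
  have hre : Continuous fun s : ℂ => s.re := Complex.continuous_re
  have him : Continuous fun s : ℂ => s.im := Complex.continuous_im
  have U1 : IsOpen {s : ℂ | 2 < s.re} := isOpen_lt continuous_const hre
  have U2 : IsOpen ({s : ℂ | -1 < s.re} ∩ {s : ℂ | 0 < s.im}) :=
    (isOpen_lt continuous_const hre).inter (isOpen_lt continuous_const him)
  have U3 : IsOpen ({s : ℂ | -1 < s.re} ∩ {s : ℂ | s.re < 1}) :=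
    (isOpen_lt continuous_const hre).inter (isOpen_lt hre continuous_const)
  have e1 : EqOn F G {s : ℂ | 2 < s.re} := fun s hs => (hF.2 s hs).unique (hG.2 s hs)
  have e2 : EqOn F G ({s : ℂ | -1 < s.re} ∩ {s : ℂ | 0 < s.im}) := by
    refine ext U2 ((convex_halfSpace_re_gt _).inter (convex_halfSpace_im_gt _)) ?_
      (s₀ := 3 + Complex.I) (by refine ⟨?_, ?_⟩ <;> norm_num)
      (e1.eventuallyEq_of_mem (U1.mem_nhds (by simp; norm_num)))
    rintro s ⟨h1, h2⟩
    refine ⟨h1, ?_, ?_⟩ <;> rintro rfl <;> simp at h2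
  have e3 : EqOn F G ({s : ℂ | -1 < s.re} ∩ {s : ℂ | s.re < 1}) := by
    refine ext U3 ((convex_halfSpace_re_gt _).inter (convex_halfSpace_re_lt _)) ?_
      (s₀ := Complex.I) (by constructor <;> simp)
      (e2.eventuallyEq_of_mem (U2.mem_nhds (by constructor <;> simp)))
    rintro s ⟨h1, h2⟩
    refine ⟨h1, ?_, ?_⟩ <;> rintro rfl <;> norm_num at h2
  exact (e3.eventuallyEq_of_mem (U3.mem_nhds (by constructor <;> simp))).deriv_eq

theorem doubleGamma_eq {ω z : ℝ} (hω : 0 < ω) (hz : 0 < z) :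
    doubleGamma ω z = Complex.exp
      ((1 / ω * (3 / 4) - barnesCoeffOne ω z + ∫ t in Ioi 0, barnesRemainder ω z t / t : ℝ)) := by
  have h : IsDoubleZeta ω z (doubleZeta ω z) :=
    Classical.epsilon_spec ⟨_, isDoubleZeta_barnesZeta hω hz⟩
  rw [doubleGamma, h.deriv_eq (isDoubleZeta_barnesZeta hω hz),
    (hasDerivAt_barnesZeta_zero hω hz).deriv]

/-! #### The double sine function -/

theorem integrableOn_barnesRemainder_div {ω z : ℝ} (hω : 0 < ω) (hz : 0 < z) :
    IntegrableOn (fun t => barnesRemainder ω z t / t) (Ioi 0) := by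
  have h := mellinConvergent_barnesRemainder hω hz (s := 0) (by simp)
  refine (Integrable.re h).congr ?_
  refine (ae_restrict_mem measurableSet_Ioi).mono fun t (ht : 0 < t) => ?_
  simp only [zero_sub, Complex.cpow_neg_one, smul_eq_mul]
  rw [← Complex.ofReal_inv, ← Complex.ofReal_mul]
  simp only [RCLike.re_eq_complex_re, Complex.ofReal_re]
  ring

theorem hasDerivAt_dslope_exp_neg {t : ℝ} (ht : 0 < t) :
    HasDerivAt (dslope (fun x : ℝ => Real.exp (-x)) 0) ((1 - Real.exp (-t) * (1 + t)) / t ^ 2) t := by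
  have h : HasDerivAt (fun x : ℝ => (Real.exp (-x) - 1) / x)
      ((-Real.exp (-t) * t - (Real.exp (-t) - 1) * 1) / t ^ 2) t := by
    refine HasDerivAt.div ?_ (hasDerivAt_id t) ht.ne'
    simpa using ((hasDerivAt_neg t).exp.sub_const 1)
  refine (h.congr_of_eventuallyEq ?_).congr_deriv (by ring)
  filter_upwards [lt_mem_nhds ht] with x hx
  rw [dslope_of_ne _ (ne_of_gt hx), slope_def_field]
  simp

/-- This accounts for the difference between the counterterm of `sineKernel` and those of
`barnesRemainder`, which carry `exp (-t)`. A primitive is `(exp (-t) - 1) / t`, extended to `0` by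
`dslope`. -/
theorem integral_one_sub_exp_neg_mul :
    IntegrableOn (fun t : ℝ => (1 - Real.exp (-t) * (1 + t)) / t ^ 2) (Ioi 0) ∧
      ∫ t in Ioi 0, (1 - Real.exp (-t) * (1 + t)) / t ^ 2 = (1 : ℝ) := by
  have hd : HasDerivAt (fun x : ℝ => Real.exp (-x)) (-1) 0 := by
    simpa using (hasDerivAt_neg (0 : ℝ)).exp
  have hc : ContinuousWithinAt (dslope (fun x : ℝ => Real.exp (-x)) 0) (Ici 0) 0 :=
    (continuousAt_dslope_same.2 hd.differentiableAt).continuousWithinAt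
  have hpos : ∀ t ∈ Ioi (0 : ℝ), 0 ≤ (1 - Real.exp (-t) * (1 + t)) / t ^ 2 := by
    intro t _
    have h1 : Real.exp (-t) * Real.exp t = 1 := by rw [← Real.exp_add]; simp
    have h2 := Real.add_one_le_exp t
    have h3 := Real.exp_pos (-t)
    refine div_nonneg ?_ (sq_nonneg t)
    nlinarith
  have hlim : Tendsto (dslope (fun x : ℝ => Real.exp (-x)) 0) atTop (𝓝 0) := by
    have h : Tendsto (fun x : ℝ => (Real.exp (-x) - 1) * x⁻¹) atTop (𝓝 ((0 - 1) * 0)) :=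
      (Real.tendsto_exp_neg_atTop_nhds_zero.sub_const 1).mul tendsto_inv_atTop_zero
    rw [mul_zero] at h
    refine h.congr' ?_
    filter_upwards [eventually_gt_atTop 0] with x hx
    rw [dslope_of_ne _ (ne_of_gt hx), slope_def_field]
    simp [div_eq_mul_inv]
  refine ⟨integrableOn_Ioi_deriv_of_nonneg hc (fun t ht => hasDerivAt_dslope_exp_neg ht) hpos hlim,
    ?_⟩
  rw [integral_Ioi_of_hasDerivAt_of_nonneg hc (fun t ht => hasDerivAt_dslope_exp_neg ht) hpos hlim,
    dslope_same, hd.deriv]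
  norm_num

/-- Under `z ↦ 1 + ω - z` both `barnesCoeffOne` and `barnesCoeffZero` change by `(2 z - 1 - ω) / ω`.
The first change, outside the integral, cancels against the integral of the difference in
counterterms. -/
theorem doubleSine_eq {ω z : ℝ} (hω : 0 < ω) (hz : 0 < z) (hz' : z < 1 + ω) :
    doubleSine ω z = Complex.exp (logSine ω z : ℝ) := by
  have hz'' : 0 < 1 + ω - z := by linarith
  rw [doubleSine, doubleGamma_eq hω hz, doubleGamma_eq hω hz'', ← Complex.exp_sub,
    ← Complex.ofReal_sub]
  congr 2
  have hc : barnesCoeffOne ω (1 + ω - z) = barnesCoeffOne ω z + (2 * z - 1 - ω) / ω := by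
    simp only [barnesCoeffOne]; field_simp; ring
  have hI : (∫ t in Ioi 0, barnesRemainder ω (1 + ω - z) t / t) -
      (∫ t in Ioi 0, barnesRemainder ω z t / t) - (2 * z - 1 - ω) / ω = logSine ω z := by
    have h1 := integral_one_sub_exp_neg_mul
    have e1 : (2 * z - 1 - ω) / ω = ∫ t in Ioi 0,
        (2 * z - 1 - ω) / ω * ((1 - Real.exp (-t) * (1 + t)) / t ^ 2) := by
      rw [integral_const_mul, h1.2, mul_one]
    have h2 : IntegrableOn (fun t => barnesRemainder ω (1 + ω - z) t / t -
        barnesRemainder ω z t / t) (Ioi 0) :=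
      (integrableOn_barnesRemainder_div hω hz'').sub (integrableOn_barnesRemainder_div hω hz)
    rw [e1, ← integral_sub (integrableOn_barnesRemainder_div hω hz'')
      (integrableOn_barnesRemainder_div hω hz), ← integral_sub h2 (h1.1.const_mul _), logSine]
    refine setIntegral_congr_fun measurableSet_Ioi fun t (ht : 0 < t) => ?_
    have s1 := (sinh_half_pos ht).ne'
    have s2 := (sinh_half_pos (mul_pos hω ht)).ne'
    simp only [barnesRemainder, barnesKernel, sineKernel, barnesCoeffOne, barnesCoeffZero]
    rw [show -((1 + ω - z - (1 + ω) / 2) * t) = (z - (1 + ω) / 2) * t by ring,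
      Real.sinh_eq ((z - (1 + ω) / 2) * t)]
    field_simp
    ring
  rw [hc, ← hI]
  ring

/-! ### Distribution relations -/

theorem norm_one_sub_exp (w : ℝ) :
    ‖1 - Complex.exp (2 * Real.pi * Complex.I * (w : ℂ))‖ = |2 * Real.sin (Real.pi * w)| := by
  have h := Complex.norm_exp_I_mul_ofReal_sub_one (2 * Real.pi * w)
  rw [norm_sub_rev, Real.norm_eq_abs] at h
  rw [show 2 * Real.pi * w / 2 = Real.pi * w by ring] at h
  rw [← h]
  congr 3
  push_cast
  ring

theorem sin_pi_mul_ne_zero {w : ℝ} (hw : ∀ n : ℤ, w ≠ n) : Real.sin (Real.pi * w) ≠ 0 := by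
  intro h
  obtain ⟨n, hn⟩ := Real.sin_eq_zero_iff.1 h
  refine hw n ?_
  rw [mul_comm] at hn
  exact (mul_left_cancel₀ Real.pi_ne_zero hn).symm

theorem logTwoSin_add_one (w : ℝ) : logTwoSin (w + 1) = logTwoSin w := by
  rw [logTwoSin, logTwoSin, mul_add, mul_one, Real.sin_add_pi, mul_neg, abs_neg]

theorem logTwoSin_one_sub (w : ℝ) : logTwoSin (1 - w) = logTwoSin w := by
  rw [logTwoSin, logTwoSin, mul_sub, mul_one, Real.sin_pi_sub]

theorem periodic_add_int {φ : ℝ → ℝ} (hφ : ∀ w, φ (w + 1) = φ w) (w : ℝ) (n : ℤ) :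
    φ (w + n) = φ w := by
  have h : Function.Periodic φ 1 := hφ
  simpa using (h.int_mul n) w

/-- Take absolute values in the factorization of `X ^ M - α ^ M` over the `M`-th roots of unity,
evaluated at `X = 1`. -/
theorem sum_logTwoSin {M : ℕ} (hM : 0 < M) {w : ℝ} (hw : ∀ n : ℤ, M * w ≠ n) :
    ∑ k ∈ Finset.range M, logTwoSin (w + k / M) = logTwoSin (M * w) := by
  have hM' : (M : ℝ) ≠ 0 := by exact_mod_cast hM.ne'
  have hMc : (M : ℂ) ≠ 0 := by exact_mod_cast hM.ne'
  have hζ := Complex.isPrimitiveRoot_exp M hM.ne'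
  have h := congrArg (Polynomial.eval 1) (X_pow_sub_C_eq_prod hζ hM
    (α := Complex.exp (2 * Real.pi * Complex.I * (w : ℂ))) rfl)
  simp only [Polynomial.eval_sub, Polynomial.eval_pow, Polynomial.eval_X, Polynomial.eval_C,
    one_pow, Polynomial.eval_prod] at h
  rw [← Complex.exp_nat_mul, show (M : ℂ) * (2 * Real.pi * Complex.I * (w : ℂ)) =
    2 * Real.pi * Complex.I * ((M * w : ℝ) : ℂ) by push_cast; ring] at h
  have h' := congrArg norm h
  rw [norm_one_sub_exp, norm_prod] at h'
  have e : ∀ k ∈ Finset.range M, ‖1 - Complex.exp (2 * Real.pi * Complex.I / M) ^ k *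
      Complex.exp (2 * Real.pi * Complex.I * (w : ℂ))‖ =
      |2 * Real.sin (Real.pi * (w + k / M))| := by
    intro k _
    rw [← norm_one_sub_exp, ← Complex.exp_nat_mul, ← Complex.exp_add]
    congr 3
    push_cast
    field_simp
    ring
  rw [Finset.prod_congr rfl e] at h'
  unfold logTwoSin
  rw [h', Real.log_prod]
  intro k _
  refine abs_ne_zero.2 (mul_ne_zero two_ne_zero (sin_pi_mul_ne_zero fun n hn => ?_))
  refine hw (M * n - k) ?_
  push_cast
  rw [← hn]
  field_simp
  ring

theorem sum_range_coprime {f : ℤ → ℝ} {q : ℕ} (hq : 0 < q) (hf : ∀ k, f (k + q) = f k) {p : ℤ}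
    (hp : IsCoprime p (q : ℤ)) (n : ℤ) :
    ∑ r ∈ Finset.range q, f (p * r + n) = ∑ r ∈ Finset.range q, f r := by
  have hper (a b : ℤ) (h : (a : ZMod q) = b) : f a = f b := by
    rw [ZMod.intCast_eq_intCast_iff_dvd_sub] at h
    obtain ⟨c, hc⟩ := h
    have hP : Function.Periodic f (q : ℤ) := hf
    have := hP.int_mul c a
    rw [← this]
    congr 1
    simp only [Int.cast_id]
    linear_combination (-1 : ℤ) * hc
  have : NeZero q := ⟨hq.ne'⟩
  have hsum (g : ZMod q → ℝ) : ∑ r ∈ Finset.range q, g r = ∑ x : ZMod q, g x := by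
    refine Finset.sum_nbij' (fun r => (r : ZMod q)) ZMod.val (by simp)
      (fun x _ => Finset.mem_range.2 x.val_lt) (fun r hr => ?_) (by simp) (by simp)
    exact ZMod.val_cast_of_lt (Finset.mem_range.1 hr)
  have h1 : ∀ r ∈ Finset.range q, f (p * r + n) =
      (fun x : ZMod q => f (((p : ZMod q) * x + n).val : ℤ)) r := fun r _ => by
    apply hper; push_cast; simp
  have h2 : ∀ r ∈ Finset.range q, f r = (fun x : ZMod q => f (x.val : ℤ)) r := fun r _ => by
    apply hper; simp
  rw [Finset.sum_congr rfl h1, Finset.sum_congr rfl h2,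
    hsum fun x : ZMod q => f (((p : ZMod q) * x + n).val : ℤ), hsum fun x : ZMod q => f (x.val : ℤ)]
  have hbij : Function.Bijective fun x : ZMod q => (p : ZMod q) * x + n := by
    rw [← Finite.injective_iff_bijective]
    intro x y hxy
    obtain ⟨u, v, huv⟩ := hp
    have hu : (u : ZMod q) * p = 1 := by
      have := congrArg (Int.cast : ℤ → ZMod q) huv
      simpa using this
    have h3 : (p : ZMod q) * x = p * y := add_right_cancel hxy
    calc x = u * p * x := by rw [hu, one_mul]
      _ = u * (p * y) := by rw [mul_assoc, h3]
      _ = y := by rw [← mul_assoc, hu, one_mul]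
  exact hbij.sum_comp fun x : ZMod q => f (x.val : ℤ)

theorem sum_periodic {φ : ℝ → ℝ} (hφ : ∀ w, φ (w + 1) = φ w) {q : ℕ} (hq : 0 < q) {p : ℤ}
    (hp : IsCoprime p (q : ℤ)) (n : ℤ) (β : ℝ) :
    ∑ r ∈ Finset.range q, φ (β + (p * r + n) / q) = ∑ r ∈ Finset.range q, φ (β + r / q) := by
  have hq' : (q : ℝ) ≠ 0 := by exact_mod_cast hq.ne'
  have h := sum_range_coprime (f := fun k : ℤ => φ (β + k / q)) hq (fun k => ?_) hp n
  · push_cast at h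
    exact h
  · push_cast
    rw [add_div, div_self hq', ← add_assoc, hφ]

/-! ### The double sine function at rational periods -/

/-- The periodic function `logSine 1 w - (1 - w) * logTwoSin w`; it is proportional to the
Clausen function. -/
def clausenPart (w : ℝ) : ℝ :=
  logSine 1 (Int.fract w) - (1 - Int.fract w) * logTwoSin (Int.fract w)

theorem clausenPart_add_one (w : ℝ) : clausenPart (w + 1) = clausenPart w := by
  rw [clausenPart, clausenPart, Int.fract_add_one]

/-- The range extends beyond `1` because the difference equation at period `1` matches the change of
the factor `1 - w`. -/
theorem logSine_one_eq {w : ℝ} (hw : 0 < w) (hw2 : w < 2) (hw1 : w ≠ 1) :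
    logSine 1 w = (1 - w) * logTwoSin w + clausenPart w := by
  rcases lt_or_gt_of_ne hw1 with h | h
  · rw [clausenPart, Int.fract_eq_self.2 ⟨hw.le, h⟩]
    ring
  · obtain ⟨v, rfl⟩ : ∃ v, w = v + 1 := ⟨w - 1, by ring⟩
    rw [clausenPart, Int.fract_add_one, Int.fract_eq_self.2 ⟨by linarith, by linarith⟩,
      logTwoSin_add_one, logSine_add_one one_pos (by linarith) (by linarith), div_one]
    ring

theorem logTwoSin_eq_log {w : ℝ} (hw : 0 < w) (hw' : w < 1) :
    logTwoSin w = Real.log (2 * Real.sin (Real.pi * w)) := by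
  have hs : 0 < Real.sin (Real.pi * w) :=
    Real.sin_pos_of_pos_of_lt_pi (by positivity) (by nlinarith [Real.pi_pos])
  rw [logTwoSin, abs_of_pos (by positivity)]

theorem abs_mul_logTwoSin_le {w : ℝ} (hw : 0 < w) (hw' : w ≤ 1 / 2) : |w * logTwoSin w| ≤ 1 := by
  have hs : 4 * w ≤ 2 * Real.sin (Real.pi * w) := by
    have h := Real.mul_le_sin (x := Real.pi * w) (by positivity)
      (by nlinarith [Real.pi_pos])
    have : 2 / Real.pi * (Real.pi * w) = 2 * w := by field_simp
    linarith
  have hs2 := Real.sin_le_one (Real.pi * w)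
  have h0 : 0 < 2 * Real.sin (Real.pi * w) := by linarith
  rw [logTwoSin_eq_log hw (by linarith), abs_le]
  constructor
  · have h1 := Real.one_sub_inv_le_log_of_pos h0
    have h2 : (2 * Real.sin (Real.pi * w))⁻¹ ≤ (4 * w)⁻¹ := inv_anti₀ (by positivity) hs
    have h3 : w * (4 * w)⁻¹ = 1 / 4 := by field_simp
    nlinarith
  · have h1 := Real.log_le_sub_one_of_pos h0
    nlinarith

theorem clausenPart_one_sub {w : ℝ} (hw : 0 < w) (hw' : w < 1) :
    clausenPart (1 - w) = -clausenPart w := by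
  have h1 := logSine_add_one one_pos (z := 1 - w) (by linarith) (by linarith)
  have h2 := logSine_reflect 1 w
  rw [show 1 + 1 - w = 1 - w + 1 by ring, h1, div_one, logTwoSin_one_sub] at h2
  rw [clausenPart, clausenPart, Int.fract_eq_self.2 ⟨by linarith, by linarith⟩,
    Int.fract_eq_self.2 ⟨hw.le, hw'⟩, logTwoSin_one_sub]
  linarith

/-- For small `w`, the shift to `w + 1` stays in a compact range for `logSine` and leaves only the
bounded term `w log (2 sin (π w))`. The interval `(1/2, 1)` follows by oddness. -/
theorem exists_bound_clausenPart : ∃ B : ℝ, ∀ w : ℝ, (∀ n : ℤ, w ≠ n) → |clausenPart w| ≤ B := by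
  obtain ⟨B, hB⟩ := exists_bound_logSine (m := 1) (M := 1) (δ := 1 / 2) one_pos (by norm_num)
  have half {w : ℝ} (hw : 0 < w) (hw' : w ≤ 1 / 2) : |clausenPart w| ≤ B + 1 := by
    have h1 := logSine_add_one one_pos hw (by linarith : w < 1)
    have h2 := hB 1 ⟨le_rfl, le_rfl⟩ (w + 1) ⟨by linarith, by linarith⟩
    have e : clausenPart w = logSine 1 (w + 1) + w * logTwoSin w := by
      rw [clausenPart, Int.fract_eq_self.2 ⟨hw.le, by linarith⟩, h1, div_one]
      ring
    rw [e]
    exact (abs_add_le _ _).trans (add_le_add h2 (abs_mul_logTwoSin_le hw hw'))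
  refine ⟨B + 1, fun w hw => ?_⟩
  have e : clausenPart w = clausenPart (Int.fract w) := by
    rw [clausenPart, clausenPart, Int.fract_fract]
  have h0 : 0 < Int.fract w := by
    refine lt_of_le_of_ne (Int.fract_nonneg w) fun h => hw ⌊w⌋ ?_
    rw [← Int.self_sub_floor] at h
    linarith
  rw [e]
  rcases le_or_gt (Int.fract w) (1 / 2) with h | h
  · exact half h0 h
  · have h3 := half (w := 1 - Int.fract w) (by linarith [Int.fract_lt_one w]) (by linarith)
    rwa [clausenPart_one_sub h0 (Int.fract_lt_one w), abs_neg] at h3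

/-- The multiplication formula with factor `q` turns the period `p / q` into `p`, homogeneity turns
it into `1 / p`, and a second use with factor `p` reaches period `1`. -/
theorem logSine_rat_eq_sum {p q : ℕ} (hp : 0 < p) (hq : 0 < q) {z : ℝ} (hz : 0 < z)
    (hz' : z < 1 + p / q) (hne : ∀ r i : ℕ, z / p + r / q + i / p ≠ 1) :
    logSine (p / q) z = ∑ r ∈ Finset.range q, ∑ i ∈ Finset.range p,
      ((1 - (z / p + r / q + i / p)) * logTwoSin (z / p + r / q + i / p) +
        clausenPart (z / p + r / q + i / p)) := by
  have hp' : (0 : ℝ) < p := by exact_mod_cast hp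
  have hq' : (0 : ℝ) < q := by exact_mod_cast hq
  rw [logSine_eq_sum (div_pos hp' hq') hz hz' hq]
  refine Finset.sum_congr rfl fun r hr => ?_
  have hr' : (r : ℝ) + 1 ≤ q := by exact_mod_cast Finset.mem_range.1 hr
  have hr0 : (0 : ℝ) ≤ r := r.cast_nonneg
  rw [mul_div_cancel₀ _ hq'.ne']
  set w := z + r * (p / q) with hw
  have hw0 : 0 < w := by positivity
  have hw1 : w < 1 + p := by
    have : (r + 1 : ℝ) * (p / q) ≤ q * (p / q) := by gcongr
    rw [mul_div_cancel₀ _ hq'.ne'] at this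
    rw [hw]
    linarith
  have hwp : w / p = z / p + r / q := by rw [hw]; field_simp
  have hw2 : w / p < 1 + (p : ℝ)⁻¹ := by
    rw [div_lt_iff₀ hp', add_mul, inv_mul_cancel₀ hp'.ne']
    linarith
  rw [← logSine_inv hp', logSine_eq_sum (inv_pos.2 hp') (div_pos hw0 hp') hw2 hp,
    mul_inv_cancel₀ hp'.ne', hwp]
  refine Finset.sum_congr rfl fun i hi => ?_
  have hi' : (i : ℝ) + 1 ≤ p := by exact_mod_cast Finset.mem_range.1 hi
  have hi0 : (0 : ℝ) ≤ i := i.cast_nonneg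
  rw [← div_eq_mul_inv]
  apply logSine_one_eq
  · positivity
  · rw [← hwp, ← add_div, div_lt_iff₀ hp']
    linarith
  · exact hne r i

theorem sum_sum_range (L : ℕ → ℝ) (n : ℕ) :
    ∑ r ∈ Finset.range n, ∑ j ∈ Finset.range r, L j =
      ∑ j ∈ Finset.range n, ((n : ℝ) - 1 - j) * L j := by
  induction n with
  | zero => simp
  | succ n ih =>
    rw [Finset.sum_range_succ, ih, ← Finset.sum_add_distrib, Finset.sum_range_succ]
    push_cast
    rw [show ((n : ℝ) + 1 - 1 - n) * L n = 0 by ring, add_zero]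
    exact Finset.sum_congr rfl fun j _ => by ring

theorem sum_sum_logTwoSin {M : ℕ} (hM : 0 < M) {v : ℝ} (hv : ∀ n : ℤ, v ≠ n) :
    ∑ r ∈ Finset.range M, ∑ i ∈ Finset.range M,
      (1 - (v / M + r / M + i / M)) * logTwoSin (v / M + r / M + i / M) =
      (1 - v) * logTwoSin v := by
  have hM' : (M : ℝ) ≠ 0 := by exact_mod_cast hM.ne'
  set L : ℕ → ℝ := fun k => logTwoSin (v / M + k / M) with hL
  set G : ℕ → ℝ := fun k => (1 - (v + k) / M) * L k with hG
  have hLM (k : ℕ) : L (k + M) = L k := by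
    simp only [hL]
    push_cast
    rw [add_div, div_self hM', ← add_assoc, logTwoSin_add_one]
  -- Moving the window of summation by one step replaces `G r` by `G (r + M)`; the periodicity of
  -- `L` makes the change equal to `-L r`.
  have hS (r : ℕ) : ∑ i ∈ Finset.range M, G (r + i) =
      ∑ i ∈ Finset.range M, G i - ∑ j ∈ Finset.range r, L j := by
    induction r with
    | zero => simp
    | succ r ih =>
      have h1 : ∑ i ∈ Finset.range M, G (r + 1 + i) = ∑ i ∈ Finset.range M, G (r + i) +
          (G (r + M) - G r) := by
        have := Finset.sum_range_succ (fun i => G (r + i)) M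
        rw [Finset.sum_range_succ'] at this
        simp only [add_zero] at this
        have e : ∀ i ∈ Finset.range M, G (r + 1 + i) = G (r + (i + 1)) := fun i _ => by
          congr 1; ring
        rw [Finset.sum_congr rfl e]
        linarith
      have h2 : G (r + M) - G r = -L r := by
        simp only [hG, hLM]
        push_cast
        field_simp
        ring
      rw [h1, ih, h2, Finset.sum_range_succ]
      ring
  have e1 : ∀ r ∈ Finset.range M, ∑ i ∈ Finset.range M,
      (1 - (v / M + r / M + i / M)) * logTwoSin (v / M + r / M + i / M) =
      ∑ i ∈ Finset.range M, G i - ∑ j ∈ Finset.range r, L j := by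
    intro r _
    rw [← hS]
    refine Finset.sum_congr rfl fun i _ => ?_
    simp only [hG, hL]
    push_cast
    rw [add_div, add_div, ← add_assoc]
  rw [Finset.sum_congr rfl e1, Finset.sum_sub_distrib, sum_sum_range, Finset.sum_const,
    Finset.card_range, nsmul_eq_mul, Finset.mul_sum, ← Finset.sum_sub_distrib]
  have e2 : ∀ j ∈ Finset.range M, (M : ℝ) * G j - ((M : ℝ) - 1 - j) * L j =
      (1 - v) * logTwoSin (v / M + j / M) := by
    intro j _
    simp only [hG, hL]
    field_simp
    ring
  rw [Finset.sum_congr rfl e2, ← Finset.mul_sum, sum_logTwoSin hM, mul_div_cancel₀ _ hM']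
  rwa [mul_div_cancel₀ _ hM']

/-- Apply `logSine_rat_eq_sum` with `p = q = M`, where both sides have period `1`. The log-sine
parts agree by `sum_sum_logTwoSin`, and what remains is the distribution relation repeated `M`
times. -/
theorem sum_clausenPart {M : ℕ} (hM : 0 < M) {w : ℝ} (hw : ∀ n : ℤ, M * w ≠ n) :
    ∑ k ∈ Finset.range M, clausenPart (w + k / M) = clausenPart (M * w) / M := by
  have hM' : (M : ℝ) ≠ 0 := by exact_mod_cast hM.ne'
  have hc1 : IsCoprime (1 : ℤ) (M : ℤ) := isCoprime_one_left
  have unit {v : ℝ} (h0 : 0 < v) (h1 : v < 1) :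
      ∑ k ∈ Finset.range M, clausenPart (v / M + k / M) = clausenPart v / M := by
    have hvn : ∀ n : ℤ, v ≠ n := by
      rintro n rfl
      have a : 0 < n := by exact_mod_cast h0
      have b : n < 1 := by exact_mod_cast h1
      omega
    have h := logSine_rat_eq_sum hM hM h0 (by rw [div_self hM']; linarith) (fun r i hri => by
      refine hvn (M - r - i) ?_
      field_simp at hri
      push_cast
      linarith)
    rw [div_self hM', logSine_one_eq h0 (by linarith) h1.ne] at h
    simp only [Finset.sum_add_distrib] at h
    rw [sum_sum_logTwoSin hM hvn, add_left_cancel_iff] at h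
    have e : ∀ r ∈ Finset.range M, ∑ i ∈ Finset.range M, clausenPart (v / M + r / M + i / M) =
        ∑ i ∈ Finset.range M, clausenPart (v / M + i / M) := by
      intro r _
      rw [← sum_periodic clausenPart_add_one hM hc1 r (v / M)]
      refine Finset.sum_congr rfl fun i _ => ?_
      push_cast
      congr 1
      ring
    rw [Finset.sum_congr rfl e, Finset.sum_const, Finset.card_range, nsmul_eq_mul] at h
    rw [h, mul_div_cancel_left₀ _ hM']
  have h0 : 0 < Int.fract (M * w) := by
    refine lt_of_le_of_ne (Int.fract_nonneg _) fun h => hw ⌊M * w⌋ ?_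
    rw [← Int.self_sub_floor] at h
    linarith
  have h1 := unit h0 (Int.fract_lt_one _)
  have e : clausenPart (Int.fract (M * w)) = clausenPart (M * w) := by
    rw [clausenPart, clausenPart, Int.fract_fract]
  rw [← e, ← h1, ← sum_periodic clausenPart_add_one hM hc1 (-⌊M * w⌋)]
  refine Finset.sum_congr rfl fun k _ => ?_
  congr 1
  rw [← Int.self_sub_floor]
  push_cast
  field_simp
  ring

/-! ### Comparison with the cyclic quantum dilogarithm -/

/-- The logarithm of the absolute value of the cyclic quantum dilogarithm
`∏ (1 - exp (2 π i (k t + c))) ^ (k / q)`. -/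
def logDilog (q : ℕ) (t c : ℝ) : ℝ :=
  ∑ k ∈ Finset.range q, (k : ℝ) / q * logTwoSin (k * t + c)

theorem logDilog_add_int (q : ℕ) (t c : ℝ) (n : ℤ) : logDilog q t (c + n) = logDilog q t c := by
  unfold logDilog
  refine Finset.sum_congr rfl fun k _ => ?_
  rw [← add_assoc, periodic_add_int logTwoSin_add_one]

/-- In the double sum over `r` and `i` the weight is `(1 - x / q - y / p) - r / q - i / p`. Its
three parts give, by the distribution relations, one log-sine at `p x + q y` and the two
dilogarithms; coprimality permutes the residues. -/
theorem logSine_rat {p q : ℕ} (hp : 0 < p) (hq : 0 < q) (hpq : p.Coprime q) {x y : ℝ} (hx : 0 < x)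
    (hx' : x ≤ 1) (hy : 0 ≤ y) (hy' : y < 1) (hn : ∀ n : ℤ, p * x + q * y ≠ n) :
    logSine (p / q) (x * (p / q) + y) =
      (1 - x / q - y / p) * logTwoSin (p * x + q * y) - logDilog q (p / q) (x * (p / q) + y) -
        logDilog p (q / p) (y * (q / p) + x) + clausenPart (p * x + q * y) / (p * q) := by
  have hp' : (0 : ℝ) < p := by exact_mod_cast hp
  have hq' : (0 : ℝ) < q := by exact_mod_cast hq
  have c1 : IsCoprime (p : ℤ) (q : ℤ) := Nat.isCoprime_iff_coprime.2 hpq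
  have hz1 : x * (p / q : ℝ) ≤ 1 * (p / q) := by gcongr
  set z := x * (p / q : ℝ) + y with hz
  have hw (r i : ℕ) : z / p + r / q + i / p = (x + r) / q + y / p + i / p := by
    rw [hz]; field_simp; ring
  have hqz : p * x + q * y = q * z := by rw [hz]; field_simp
  have hpne (r : ℕ) : ∀ n : ℤ, p * ((x + r) / q + y / p) ≠ n := by
    intro n h
    refine hn (q * n - p * r) ?_
    field_simp at h
    push_cast
    linarith
  have hqne (i : ℕ) : ∀ n : ℤ, q * (x / q + (y + i) / p) ≠ n := by
    intro n h
    refine hn (p * n - q * i) ?_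
    field_simp at h
    push_cast
    linarith
  have hqzne : ∀ n : ℤ, q * (z : ℝ) ≠ n := by rwa [hqz] at hn
  rw [logSine_rat_eq_sum hp hq (by positivity) (by linarith) fun r i h => by
    rw [hw] at h
    refine hn (p * q - r * p - i * q) ?_
    field_simp at h
    push_cast
    linarith]
  have inner (φ : ℝ → ℝ) (hφ : ∀ w, φ (w + 1) = φ w) :
      ∑ r ∈ Finset.range q, φ (p * ((x + r) / q + y / p)) = ∑ r ∈ Finset.range q, φ (z + r / q) := by
    rw [← sum_periodic hφ hq c1 0 z]
    refine Finset.sum_congr rfl fun r _ => ?_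
    congr 1
    push_cast
    rw [hz]
    field_simp
    ring
  have hC : ∑ r ∈ Finset.range q, ∑ i ∈ Finset.range p, clausenPart (z / p + r / q + i / p) =
      clausenPart (p * x + q * y) / (p * q) := by
    have e : ∀ r ∈ Finset.range q, ∑ i ∈ Finset.range p, clausenPart (z / p + r / q + i / p) =
        clausenPart (p * ((x + r) / q + y / p)) / p := by
      intro r _
      simp only [hw]
      exact sum_clausenPart hp (hpne r)
    rw [Finset.sum_congr rfl e, ← Finset.sum_div, inner _ clausenPart_add_one,
      sum_clausenPart hq hqzne, hqz]
    field_simp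
  have hL (r : ℕ) : ∑ i ∈ Finset.range p, logTwoSin (z / p + r / q + i / p) =
      logTwoSin (p * ((x + r) / q + y / p)) := by
    simp only [hw]
    exact sum_logTwoSin hp (hpne r)
  have hL' (i : ℕ) : ∑ r ∈ Finset.range q, logTwoSin (z / p + r / q + i / p) =
      logTwoSin (q * (x / q + (y + i) / p)) := by
    rw [← sum_logTwoSin hq (hqne i)]
    refine Finset.sum_congr rfl fun r _ => ?_
    rw [hw]
    congr 1
    ring
  have h1 : ∑ r ∈ Finset.range q, ∑ i ∈ Finset.range p, logTwoSin (z / p + r / q + i / p) =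
      logTwoSin (p * x + q * y) := by
    simp only [hL]
    rw [inner _ logTwoSin_add_one, sum_logTwoSin hq hqzne, hqz]
  have h2 : ∑ r ∈ Finset.range q, ∑ i ∈ Finset.range p,
      (r : ℝ) / q * logTwoSin (z / p + r / q + i / p) = logDilog q (p / q) z := by
    simp only [← Finset.mul_sum, hL]
    rw [logDilog]
    refine Finset.sum_congr rfl fun r _ => ?_
    congr 2
    rw [hz]
    field_simp
    ring
  have h3 : ∑ r ∈ Finset.range q, ∑ i ∈ Finset.range p,
      (i : ℝ) / p * logTwoSin (z / p + r / q + i / p) = logDilog p (q / p) (y * (q / p) + x) := by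
    rw [Finset.sum_comm]
    simp only [← Finset.mul_sum, hL']
    rw [logDilog]
    refine Finset.sum_congr rfl fun r _ => ?_
    congr 2
    field_simp
    ring
  rw [← hC, ← h1, ← h2, ← h3, Finset.mul_sum, ← Finset.sum_sub_distrib, ← Finset.sum_sub_distrib,
    ← Finset.sum_add_distrib]
  refine Finset.sum_congr rfl fun r _ => ?_
  rw [Finset.mul_sum, ← Finset.sum_sub_distrib, ← Finset.sum_sub_distrib,
    ← Finset.sum_add_distrib]
  refine Finset.sum_congr rfl fun i _ => ?_
  have : z / p = x / q + y / p := by rw [hz]; field_simp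
  rw [show 1 - (z / p + r / q + i / p) = (1 - x / q - y / p) - r / q - i / p by rw [this]; ring]
  ring

/-- Since `p ≡ -q'` modulo `q`, replacing `k` by `q - 1 - k` converts one dilogarithm into the
other. The weights become `(1 - 1 / q) - k / q`, and the constant part is summed by `sum_logTwoSin`.
-/
theorem logDilog_reflect {q : ℕ} (hq : 0 < q) {a p q' : ℤ} (hp : p = a * q - q')
    (hc : IsCoprime q' (q : ℤ)) {x y : ℝ} (hn : ∀ n : ℤ, p * x + q * y ≠ n) :
    logDilog q (p / q) (x * (p / q) + y) = (1 - 1 / q) * logTwoSin (p * x + q * y) -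
      logDilog q (q' / q) ((1 - x) * (q' / q) + (a * x + y)) := by
  have hq' : (0 : ℝ) < q := by exact_mod_cast hq
  have hpR : (p : ℝ) = a * q - q' := by rw [hp]; push_cast; ring
  set β := (1 - x) * (q' / q : ℝ) + (a * x + y) with hβ
  have hqβ : q * β = p * x + q * y + q' := by rw [hβ, hpR]; field_simp; ring
  have hs : ∑ k ∈ Finset.range q, logTwoSin (k * (q' / q) + β) = logTwoSin (p * x + q * y) := by
    rw [← periodic_add_int logTwoSin_add_one _ q', ← hqβ, ← sum_logTwoSin hq,
      ← sum_periodic logTwoSin_add_one hq hc 0 β]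
    · refine Finset.sum_congr rfl fun k _ => ?_
      congr 1
      push_cast
      ring
    · intro n h
      refine hn (n - q') ?_
      push_cast
      linarith
  rw [← hs, Finset.mul_sum, logDilog, logDilog, ← Finset.sum_sub_distrib,
    ← Finset.sum_range_reflect]
  refine Finset.sum_congr rfl fun k hk => ?_
  have hk' : k + 1 ≤ q := Finset.mem_range.1 hk
  have e : ((q - 1 - k : ℕ) : ℝ) = q - 1 - k := by
    rw [Nat.sub_sub, Nat.cast_sub (by omega)]
    push_cast
    ring
  rw [e, ← periodic_add_int logTwoSin_add_one (k * (q' / q) + β) (a * (q - 1 - k) - q')]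
  have e2 : ((q : ℝ) - 1 - k) * (p / q) + (x * (p / q) + y) =
      k * (q' / q) + β + ((a * (q - 1 - k) - q' : ℤ) : ℝ) := by
    push_cast
    rw [hβ, hpR]
    field_simp
    ring
  rw [e2]
  field_simp

/-! ### Normalized orbits -/

theorem fract_eq_of_sub_eq {q r : ℚ} {n : ℤ} (h : q - r = n) : Int.fract q = Int.fract r := by
  rw [show q = r + n by linarith, Int.fract_add_intCast]

theorem fractOne_eq_of_sub_eq {q r : ℚ} {n : ℤ} (h : q - r = n) : fractOne q = fractOne r := by
  rw [fractOne, fractOne, fract_eq_of_sub_eq h]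

theorem exists_fract_eq (q : ℚ) : ∃ n : ℤ, Int.fract q = q + n :=
  ⟨-⌊q⌋, by rw [← Int.self_sub_floor]; push_cast; ring⟩

theorem exists_fractOne_eq (q : ℚ) : ∃ n : ℤ, fractOne q = q + n := by
  obtain ⟨n, hn⟩ := exists_fract_eq q
  unfold fractOne
  split_ifs with h
  · exact ⟨n + 1, by push_cast; linarith⟩
  · exact ⟨n, hn⟩

theorem fractOne_pos (q : ℚ) : 0 < fractOne q := by
  unfold fractOne
  split_ifs with h
  · exact one_pos
  · exact lt_of_le_of_ne (Int.fract_nonneg q) (Ne.symm h)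

theorem fractOne_le_one (q : ℚ) : fractOne q ≤ 1 := by
  unfold fractOne
  split_ifs with h
  · exact le_rfl
  · exact (Int.fract_lt_one q).le

theorem fractOne_eq_self {q : ℚ} (h : 0 < q) (h' : q < 1) : fractOne q = q := by
  have : Int.fract q = q := Int.fract_eq_self.2 ⟨h.le, h'⟩
  rw [fractOne, this, if_neg h.ne']

theorem orbitStep_eq (a : ℕ) (p : ℚ × ℚ) :
    orbitStep a p = (fractOne (a * p.1 + p.2), Int.fract (-p.1)) := by
  simp [orbitStep, matU, Matrix.vecMul, dotProduct, Fin.sum_univ_two, mul_comm]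

/-- The pairs `(x, y)` with `0 < x ≤ 1` and `0 ≤ y < 1`. -/
def IsNormalized (p : ℚ × ℚ) : Prop :=
  0 < p.1 ∧ p.1 ≤ 1 ∧ 0 ≤ p.2 ∧ p.2 < 1

theorem isNormalized_orbitStep (a : ℕ) (p : ℚ × ℚ) : IsNormalized (orbitStep a p) := by
  rw [orbitStep_eq]
  exact ⟨fractOne_pos _, fractOne_le_one _, Int.fract_nonneg _, Int.fract_lt_one _⟩

theorem IsNormalized.iterate {a : ℕ} {p : ℚ × ℚ} (hp : IsNormalized p) (l : ℕ) :
    IsNormalized ((orbitStep a)^[l] p) := by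
  cases l with
  | zero => exact hp
  | succ l => rw [Function.iterate_succ_apply']; exact isNormalized_orbitStep a _

/-- The convention `0 < x ≤ 1` makes this exact, including at `x = 1`; it matches the argument `1 -
x` in `logDilog_reflect`. -/
theorem IsNormalized.orbitStep_snd {a : ℕ} {p : ℚ × ℚ} (hp : IsNormalized p) :
    (orbitStep a p).2 = 1 - p.1 := by
  rw [orbitStep_eq]
  simp only
  rw [Int.fract_eq_iff]
  exact ⟨by linarith [hp.2.1], by linarith [hp.1], -1, by push_cast; ring⟩

theorem initialPair_zero (d a : ℕ) {b : ℕ} (hb : 0 < b) {u : ℤ} (hu : u ≠ 0) :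
    initialPair d a b u 0 = (1, Int.fract (1 / (u : ℚ))) := by
  have hb' : (b : ℚ) ≠ 0 := by exact_mod_cast hb.ne'
  have hu' : (u : ℚ) ≠ 0 := by exact_mod_cast hu
  have h : |u ^ 2 - (d : ℤ) * 0 ^ 2| = u ^ 2 := by
    rw [zero_pow two_ne_zero, mul_zero, sub_zero, abs_of_nonneg (sq_nonneg u)]
  unfold initialPair
  rw [h]
  congr 1
  · simp [fractOne]
  · congr 1
    push_cast
    field_simp
    ring

theorem fract_one_div_ne_zero {u : ℤ} (hu : 1 < |u|) : Int.fract (1 / (u : ℚ)) ≠ 0 := by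
  have hu0 : u ≠ 0 := by rintro rfl; simp at hu
  have hu' : (u : ℚ) ≠ 0 := by exact_mod_cast hu0
  intro h
  rw [← Int.self_sub_floor, sub_eq_zero, div_eq_iff hu'] at h
  have h2 : ⌊1 / (u : ℚ)⌋ * u = 1 := by exact_mod_cast h.symm
  have h3 : IsUnit u := IsUnit.of_mul_eq_one _ (by rw [mul_comm]; exact h2)
  rw [Int.isUnit_iff_abs_eq] at h3
  omega

theorem isNormalized_one_fract (q : ℚ) : IsNormalized (1, Int.fract q) :=
  ⟨one_pos, le_rfl, Int.fract_nonneg _, Int.fract_lt_one _⟩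

/-! ### Reversal of a closed orbit and equality of the products at `ω` and `ω⁻¹`. -/

/-- The exchange of the two coordinates, followed by normalization. -/
def swapPair (p : ℚ × ℚ) : ℚ × ℚ :=
  (fractOne p.2, Int.fract p.1)

/-- Exchanging coordinates conjugates `U` to `U⁻¹`, so the exchange runs orbits backwards. -/
theorem orbitStep_swapPair_orbitStep (a : ℕ) (p : ℚ × ℚ) :
    orbitStep a (swapPair (orbitStep a p)) = swapPair p := by
  obtain ⟨n₁, h₁⟩ := exists_fractOne_eq (a * p.1 + p.2)
  obtain ⟨n₂, h₂⟩ := exists_fract_eq (-p.1)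
  obtain ⟨n₃, h₃⟩ := exists_fractOne_eq (Int.fract (-p.1))
  obtain ⟨n₄, h₄⟩ := exists_fract_eq (fractOne (a * p.1 + p.2))
  rw [orbitStep_eq, orbitStep_eq]
  simp only [swapPair]
  refine Prod.ext ?_ ?_
  · apply fractOne_eq_of_sub_eq (n := a * (n₂ + n₃) + n₁ + n₄)
    rw [h₃, h₂, h₄, h₁]
    push_cast
    ring
  · apply fract_eq_of_sub_eq (n := -(n₂ + n₃))
    rw [h₃, h₂]
    push_cast
    ring

/-- Both sides are `(y, 0)` modulo `1`. This self-duality of the starting pair is what keeps the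
reversed orbit inside the original one. -/
theorem swapPair_one_fract (a : ℕ) (q : ℚ) :
    swapPair (1, Int.fract q) = orbitStep a (1, Int.fract q) := by
  rw [orbitStep_eq]
  refine Prod.ext ?_ ?_
  · exact fractOne_eq_of_sub_eq (n := -a) (by push_cast; ring)
  · exact fract_eq_of_sub_eq (n := 2) (by norm_num)

section Orbit

variable {a g : ℕ} {f : ℚ}

theorem sum_orbit_succ {p : ℚ × ℚ} (horb : (orbitStep a)^[g] p = p) (F : ℚ × ℚ → ℝ) :
    ∑ l ∈ Finset.range g, F ((orbitStep a)^[l + 1] p) =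
      ∑ l ∈ Finset.range g, F ((orbitStep a)^[l] p) := by
  have h := Finset.sum_range_succ (fun l => F ((orbitStep a)^[l] p)) g
  rw [Finset.sum_range_succ', horb, Function.iterate_zero_apply] at h
  exact add_right_cancel h

theorem swapPair_iterate {p : ℚ × ℚ} (horb : (orbitStep a)^[g] p = p)
    (hp : swapPair p = orbitStep a p) {j : ℕ} (hj : j ≤ g) :
    swapPair ((orbitStep a)^[g - j] p) = (orbitStep a)^[j + 1] p := by
  induction j with
  | zero => rw [Nat.sub_zero, horb, hp, zero_add, Function.iterate_one]
  | succ j ih =>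
    have h : g - j = (g - (j + 1)) + 1 := by omega
    rw [Function.iterate_succ_apply', ← ih (by omega), h, Function.iterate_succ_apply',
      orbitStep_swapPair_orbitStep]

theorem sum_orbit_swapPair {p : ℚ × ℚ} (horb : (orbitStep a)^[g] p = p)
    (hp : swapPair p = orbitStep a p) (F : ℚ × ℚ → ℝ) :
    ∑ l ∈ Finset.range g, F (swapPair ((orbitStep a)^[l] p)) =
      ∑ l ∈ Finset.range g, F ((orbitStep a)^[l] p) := by
  rw [← sum_orbit_succ horb F, ← sum_orbit_succ horb fun p => F (swapPair p),
    ← Finset.sum_range_reflect]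
  refine Finset.sum_congr rfl fun l hl => ?_
  have hl' := Finset.mem_range.1 hl
  rw [← swapPair_iterate horb hp hl'.le]
  congr 4
  omega

/-- The pair `(1, 0)` is fixed, so a closed orbit meeting it is constant. It must be avoided because
exchanging its coordinates would meet a pole of the log-sine. -/
theorem orbit_ne_one_zero {p : ℚ × ℚ} (horb : (orbitStep a)^[g] p = p) (hp : p ≠ (1, 0)) {l : ℕ}
    (hl : l ≤ g) : (orbitStep a)^[l] p ≠ (1, 0) := by
  intro h
  have hfix : orbitStep a (1, 0) = (1, 0) := by
    rw [orbitStep_eq]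
    refine Prod.ext ?_ ?_
    · simp [fractOne]
    · exact Int.fract_eq_iff.2 ⟨le_rfl, one_pos, -1, by norm_num⟩
  refine hp ?_
  rw [← horb, show g = (g - l) + l by omega, Function.iterate_add_apply, h]
  exact Function.iterate_fixed hfix _

end Orbit

/-- `log 𝒮(ω, x ω + y)`. -/
def logSinePair (ω : ℝ) (p : ℚ × ℚ) : ℝ :=
  logSine ω (p.1 * ω + p.2)

theorem IsNormalized.pos_lt {p : ℚ × ℚ} (hp : IsNormalized p) {ω : ℝ} (hω : 0 < ω) :
    0 < p.1 * ω + p.2 ∧ p.1 * ω + p.2 < 1 + ω := by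
  obtain ⟨h1, h2, h3, h4⟩ := hp
  have h1' : (0 : ℝ) < p.1 := by exact_mod_cast h1
  have h2' : (p.1 : ℝ) ≤ 1 := by exact_mod_cast h2
  have h3' : (0 : ℝ) ≤ p.2 := by exact_mod_cast h3
  have h4' : (p.2 : ℝ) < 1 := by exact_mod_cast h4
  constructor <;> nlinarith

theorem orbitProduct_eq {a g : ℕ} {p : ℚ × ℚ} (hp : IsNormalized p) {ω : ℝ} (hω : 0 < ω) :
    orbitProduct a g p ω = Complex.exp
      (∑ l ∈ Finset.range g, logSinePair ω ((orbitStep a)^[l] p) : ℝ) := by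
  rw [orbitProduct, Complex.ofReal_sum, Complex.exp_sum]
  refine Finset.prod_congr rfl fun l _ => ?_
  have h := (hp.iterate (a := a) l).pos_lt hω
  exact doubleSine_eq hω h.1 h.2

/-- The correction term for exchanging the coordinates of a normalized pair. -/
def swapCorrection (p : ℚ × ℚ) : ℝ :=
  if p.2 = 0 then -logTwoSin p.1 else 0

/-- Normalization alters the exchanged pair only if `y = 0`, a shift by `ω`, or `x = 1`, a shift by
`1`. The latter occurs exactly when the next pair has second coordinate `0`, and its first
coordinate is then `y`; so the two corrections form a coboundary that sums to zero over a closed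
orbit. -/
theorem logSinePair_swapPair (a : ℕ) {p : ℚ × ℚ} (hp : IsNormalized p) (hne : p ≠ (1, 0)) {ω : ℝ}
    (hω : 0 < ω) :
    logSinePair ω (swapPair p) = logSine ω (p.2 * ω + p.1) +
      (swapCorrection p - swapCorrection (orbitStep a p)) := by
  have hs := hp.orbitStep_snd (a := a)
  obtain ⟨x, y⟩ := p
  obtain ⟨h1, h2, h3, h4⟩ := hp
  simp only at h1 h2 h3 h4 hs
  rw [logSinePair, swapPair, swapCorrection, swapCorrection, hs]
  simp only
  rcases eq_or_lt_of_le h3 with rfl | hy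
  · have hx : x < 1 := lt_of_le_of_ne h2 fun h => hne (by rw [h])
    have hx1 : (0 : ℝ) < x := by exact_mod_cast h1
    have hx2 : (x : ℝ) < 1 := by exact_mod_cast hx
    have hf : fractOne 0 = 1 := by simp [fractOne]
    rw [hf, Int.fract_eq_self.2 ⟨h1.le, hx⟩, if_pos rfl, if_neg (by linarith)]
    push_cast
    rw [one_mul, zero_mul, zero_add, sub_zero, add_comm, logSine_add_period hω hx1 hx2,
      sub_eq_add_neg]
  · have hy1 : (0 : ℝ) < y := by exact_mod_cast hy
    have hy2 : (y : ℝ) < 1 := by exact_mod_cast h4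
    rw [fractOne_eq_self hy h4, if_neg hy.ne']
    rcases eq_or_lt_of_le h2 with rfl | hx
    · have e : (orbitStep a (1, y)).1 = y := by
        rw [orbitStep_eq]
        simp only
        rw [fractOne_eq_of_sub_eq (r := y) (n := a) (by push_cast; ring), fractOne_eq_self hy h4]
      rw [if_pos (by norm_num), e, Int.fract_one]
      push_cast
      rw [logSine_add_one hω (by positivity) (by nlinarith), mul_div_cancel_right₀ _ hω.ne', add_zero]
      ring
    · rw [if_neg (by linarith), Int.fract_eq_self.2 ⟨h1.le, hx⟩]
      ring

theorem sum_logSinePair_inv {a g : ℕ} {q : ℚ} (hq : Int.fract q ≠ 0)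
    (horb : (orbitStep a)^[g] (1, Int.fract q) = (1, Int.fract q)) {ω : ℝ} (hω : 0 < ω) :
    ∑ l ∈ Finset.range g, logSinePair ω⁻¹ ((orbitStep a)^[l] (1, Int.fract q)) =
      ∑ l ∈ Finset.range g, logSinePair ω ((orbitStep a)^[l] (1, Int.fract q)) := by
  set p := ((1 : ℚ), Int.fract q) with hp
  have hnorm : IsNormalized p := isNormalized_one_fract q
  have hne : p ≠ (1, 0) := fun h => hq (Prod.ext_iff.1 h).2
  have e (l : ℕ) (hl : l ∈ Finset.range g) : logSinePair ω⁻¹ ((orbitStep a)^[l] p) =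
      logSinePair ω (swapPair ((orbitStep a)^[l] p)) -
      (swapCorrection ((orbitStep a)^[l] p) - swapCorrection ((orbitStep a)^[l + 1] p)) := by
    rw [logSinePair_swapPair a (hnorm.iterate l)
      (orbit_ne_one_zero horb hne (Finset.mem_range.1 hl).le) hω, Function.iterate_succ_apply',
      add_sub_cancel_right, logSinePair, ← logSine_inv hω]
    congr 1
    field_simp
    ring
  rw [Finset.sum_congr rfl e, Finset.sum_sub_distrib,
    sum_orbit_swapPair horb (swapPair_one_fract a q),
    Finset.sum_range_sub' fun l => swapCorrection ((orbitStep a)^[l] p), horb,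
    Function.iterate_zero_apply, sub_self, sub_zero]

/-! ### Denominators of the convergents -/

/-- The denominator of `tSeq a n`. -/
def tDen (a : ℕ) : ℕ → ℤ
  | 0 => (2 / Nat.gcd 2 a : ℕ)
  | 1 => (a / Nat.gcd 2 a : ℕ)
  | n + 2 => a * tDen a (n + 1) - tDen a n

theorem gcd_two_pos (a : ℕ) : 0 < Nat.gcd 2 a := Nat.gcd_pos_of_pos_left a two_pos

/-- Dividing by `gcd (2, a) = gcd (T_0(a), T_1(a))` makes the first two terms coprime, and the
recurrence preserves coprimality. -/
theorem isCoprime_tDen (a n : ℕ) : IsCoprime (tDen a n) (tDen a (n + 1)) := by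
  induction n with
  | zero =>
    simp only [tDen]
    exact Nat.isCoprime_iff_coprime.2 (Nat.coprime_div_gcd_div_gcd (gcd_two_pos a))
  | succ n ih =>
    have h : tDen a (n + 2) = -tDen a n + tDen a (n + 1) * a := by
      simp only [tDen]; ring
    rw [h]
    exact IsCoprime.add_mul_left_right ih.symm.neg_right _

theorem gcd_mul_tDen (a n : ℕ) :
    ((Nat.gcd 2 a : ℕ) : ℚ) * tDen a n = (Polynomial.Chebyshev.C ℚ (n : ℤ)).eval (a : ℚ) := by
  induction n using Nat.twoStepInduction with
  | zero =>
    have : Nat.gcd 2 a * (2 / Nat.gcd 2 a) = 2 := Nat.mul_div_cancel' (Nat.gcd_dvd_left 2 a)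
    simp only [tDen]
    rw [Int.cast_natCast, ← Nat.cast_mul, this]
    simp
  | one =>
    have : Nat.gcd 2 a * (a / Nat.gcd 2 a) = a := Nat.mul_div_cancel' (Nat.gcd_dvd_right 2 a)
    simp only [tDen]
    rw [Int.cast_natCast, ← Nat.cast_mul, this]
    simp
  | more n h0 h1 =>
    push_cast at h1 ⊢
    rw [Polynomial.Chebyshev.C_add_two, Polynomial.eval_sub, Polynomial.eval_mul,
      Polynomial.eval_X, ← h1, ← h0]
    simp only [tDen]
    push_cast
    ring

/-! ### Positivity, growth and ratios of the denominators. -/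

section Growth

variable {a : ℕ}

theorem tDen_pos_lt (ha : 3 ≤ a) (n : ℕ) : 0 < tDen a n ∧ tDen a n < tDen a (n + 1) := by
  induction n with
  | zero =>
    simp only [tDen]
    have h2 : Nat.gcd 2 a * (2 / Nat.gcd 2 a) = 2 := Nat.mul_div_cancel' (Nat.gcd_dvd_left 2 a)
    have h3 : Nat.gcd 2 a * (a / Nat.gcd 2 a) = a := Nat.mul_div_cancel' (Nat.gcd_dvd_right 2 a)
    have hg := gcd_two_pos a
    constructor
    · have : 0 < 2 / Nat.gcd 2 a := Nat.div_pos (Nat.le_of_dvd two_pos (Nat.gcd_dvd_left 2 a)) hg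
      exact_mod_cast this
    · have : 2 / Nat.gcd 2 a < a / Nat.gcd 2 a := by
        by_contra! h
        have := Nat.mul_le_mul_left (Nat.gcd 2 a) h
        omega
      exact_mod_cast this
  | succ n ih =>
    refine ⟨ih.1.trans ih.2, ?_⟩
    have : (3 : ℤ) ≤ a := by exact_mod_cast ha
    simp only [tDen]
    nlinarith [ih.1, ih.2]

theorem tDen_pos (ha : 3 ≤ a) (n : ℕ) : 0 < tDen a n := (tDen_pos_lt ha n).1

theorem le_tDen (ha : 3 ≤ a) (n : ℕ) : (n : ℤ) ≤ tDen a n := by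
  induction n with
  | zero => exact (tDen_pos ha 0).le
  | succ n ih => have := (tDen_pos_lt ha n).2; push_cast; omega

theorem tSeq_succ (ha : 3 ≤ a) (n : ℕ) : tSeq a (n + 1) = tDen a n / tDen a (n + 1) := by
  have hg : ((Nat.gcd 2 a : ℕ) : ℚ) ≠ 0 := by exact_mod_cast (gcd_two_pos a).ne'
  have h := (tDen_pos ha (n + 1)).ne'
  have h' : (tDen a (n + 1) : ℚ) ≠ 0 := by exact_mod_cast h
  rw [tSeq, ← gcd_mul_tDen, show (((n + 1 : ℕ) : ℤ) - 1) = (n : ℤ) by push_cast; ring,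
    ← gcd_mul_tDen]
  field_simp

theorem tSeq_den (ha : 3 ≤ a) (n : ℕ) : ((tSeq a (n + 1)).den : ℤ) = tDen a (n + 1) := by
  rw [tSeq_succ ha]
  exact Rat.den_div_eq_of_coprime (tDen_pos ha _) (Int.isCoprime_iff_nat_coprime.1 (isCoprime_tDen a n))

theorem gcd_mul_tDen_eq_pow {e e' : ℝ} (he : e + e' = a) (hee : e * e' = 1) (n : ℕ) :
    ((Nat.gcd 2 a : ℕ) : ℝ) * tDen a n = e ^ n + e' ^ n := by
  induction n using Nat.twoStepInduction with
  | zero =>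
    have : Nat.gcd 2 a * (2 / Nat.gcd 2 a) = 2 := Nat.mul_div_cancel' (Nat.gcd_dvd_left 2 a)
    simp only [tDen]
    rw [Int.cast_natCast, ← Nat.cast_mul, this]
    norm_num
  | one =>
    have : Nat.gcd 2 a * (a / Nat.gcd 2 a) = a := Nat.mul_div_cancel' (Nat.gcd_dvd_right 2 a)
    simp only [tDen]
    rw [Int.cast_natCast, ← Nat.cast_mul, this, pow_one, pow_one, he]
  | more n h0 h1 =>
    simp only [tDen]
    push_cast
    rw [← he] at *
    linear_combination (e + e') * h1 - h0 + (e ^ n + e' ^ n) * hee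

/-- The ratios of consecutive denominators converge to the unit. -/
theorem tendsto_tDen_ratio {e e' : ℝ} (he : e + e' = a) (hee : e * e' = 1) (he1 : 1 < e) :
    Tendsto (fun n => (tDen a (n + 1) : ℝ) / tDen a n) atTop (𝓝 e) := by
  have hg : ((Nat.gcd 2 a : ℕ) : ℝ) ≠ 0 := by exact_mod_cast (gcd_two_pos a).ne'
  have he0 : 0 < e := by linarith
  have he' : e' = e⁻¹ := eq_inv_of_mul_eq_one_right hee
  have hr1 : e⁻¹ * e⁻¹ < 1 := by
    have := inv_lt_one_of_one_lt₀ he1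
    have := inv_pos.2 he0
    nlinarith
  have hr : Tendsto (fun n : ℕ => (e⁻¹ * e⁻¹) ^ n) atTop (𝓝 0) :=
    tendsto_pow_atTop_nhds_zero_of_lt_one (by positivity) hr1
  have h : Tendsto (fun n : ℕ => (e + e⁻¹ * (e⁻¹ * e⁻¹) ^ n) / (1 + (e⁻¹ * e⁻¹) ^ n)) atTop
      (𝓝 ((e + e⁻¹ * 0) / (1 + 0))) :=
    ((hr.const_mul _).const_add _).div (hr.const_add _) (by norm_num)
  rw [mul_zero, add_zero, add_zero, div_one] at h
  refine h.congr fun n => ?_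
  have h1 := gcd_mul_tDen_eq_pow he hee n
  have h2 := gcd_mul_tDen_eq_pow he hee (n + 1)
  rw [← mul_div_mul_left (tDen a (n + 1) : ℝ) _ hg, h1, h2, he']
  have : (1 : ℝ) + (e⁻¹ * e⁻¹) ^ n ≠ 0 := by positivity
  have : e ^ n + e⁻¹ ^ n ≠ 0 := by positivity
  rw [div_eq_div_iff (by assumption) (by assumption), mul_pow, pow_succ, pow_succ]
  have hen : e ^ n * e⁻¹ ^ n = 1 := by rw [← mul_pow, mul_inv_cancel₀ he0.ne', one_pow]
  linear_combination (e⁻¹ * e⁻¹ ^ n - e * e⁻¹ ^ n) * hen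

end Growth

/-! ### The invariant of an orbit -/

/-- Applying `U` to the row `(x, y)` is the same as applying it to the column of two consecutive
denominators, which advances the recurrence by one index. -/
theorem exists_orbitStep_eq (a m : ℕ) (p : ℚ × ℚ) :
    ∃ n : ℤ, (tDen a (m + 1) : ℚ) * (orbitStep a p).1 + tDen a m * (orbitStep a p).2 =
      tDen a (m + 2) * p.1 + tDen a (m + 1) * p.2 + n := by
  obtain ⟨n₁, h₁⟩ := exists_fractOne_eq (a * p.1 + p.2)
  obtain ⟨n₂, h₂⟩ := exists_fract_eq (-p.1)
  refine ⟨tDen a (m + 1) * n₁ + tDen a m * n₂, ?_⟩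
  rw [orbitStep_eq]
  simp only [tDen]
  rw [h₁, h₂]
  push_cast
  ring

theorem exists_iterate_orbitStep_eq (a m l : ℕ) (p : ℚ × ℚ) :
    ∃ n : ℤ, (tDen a (m + 1) : ℚ) * ((orbitStep a)^[l] p).1 + tDen a m * ((orbitStep a)^[l] p).2 =
      tDen a (m + l + 1) * p.1 + tDen a (m + l) * p.2 + n := by
  induction l generalizing m with
  | zero => exact ⟨0, by simp⟩
  | succ l ih =>
    obtain ⟨n₁, h₁⟩ := exists_orbitStep_eq a m ((orbitStep a)^[l] p)
    obtain ⟨n₂, h₂⟩ := ih (m + 1)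
    refine ⟨n₁ + n₂, ?_⟩
    rw [Function.iterate_succ_apply', h₁, h₂, show m + 1 + l = m + (l + 1) by ring]
    push_cast
    ring

theorem exists_iterate_one_fract_eq (a m l : ℕ) (q : ℚ) :
    ∃ n : ℤ, (tDen a (m + 1) : ℚ) * ((orbitStep a)^[l] (1, Int.fract q)).1 +
      tDen a m * ((orbitStep a)^[l] (1, Int.fract q)).2 = tDen a (m + l) * q + n := by
  obtain ⟨n, h⟩ := exists_iterate_orbitStep_eq a m l (1, Int.fract q)
  obtain ⟨n', h'⟩ := exists_fract_eq q
  refine ⟨tDen a (m + l + 1) + tDen a (m + l) * n' + n, ?_⟩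
  rw [h]
  simp only [h']
  push_cast
  ring

/-- Pair the denominators with the orbit after `g` steps and after none: closedness equates `tDen a
(m + g) / u` and `tDen a m / u` modulo `1`. -/
theorem dvd_tDen_sub {a g : ℕ} {u : ℤ} (hu : u ≠ 0)
    (horb : (orbitStep a)^[g] (1, Int.fract (1 / (u : ℚ))) = (1, Int.fract (1 / (u : ℚ)))) (m : ℕ) :
    u ∣ tDen a (m + g) - tDen a m := by
  have hu' : (u : ℚ) ≠ 0 := by exact_mod_cast hu
  obtain ⟨n, h⟩ := exists_iterate_one_fract_eq a m g (1 / (u : ℚ))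
  obtain ⟨n', h'⟩ := exists_iterate_one_fract_eq a m 0 (1 / (u : ℚ))
  rw [horb] at h
  rw [Function.iterate_zero_apply, add_zero] at h'
  refine ⟨n' - n, ?_⟩
  have e := h.symm.trans h'
  field_simp at e
  have : (tDen a (m + g) : ℚ) - tDen a m = u * (n' - n) := by linear_combination e
  exact_mod_cast this

theorem dvd_tDen_iff {a g : ℕ} {u : ℤ} (hu : u ≠ 0)
    (horb : (orbitStep a)^[g] (1, Int.fract (1 / (u : ℚ))) = (1, Int.fract (1 / (u : ℚ)))) (m : ℕ) :
    u ∣ tDen a (m + g) ↔ u ∣ tDen a m := by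
  have := dvd_tDen_sub hu horb m
  rw [dvd_sub_comm] at this
  exact (dvd_iff_dvd_of_dvd_sub this).symm

theorem dvd_tDen_mul_iff {a g : ℕ} {u : ℤ} (hu : u ≠ 0)
    (horb : (orbitStep a)^[g] (1, Int.fract (1 / (u : ℚ))) = (1, Int.fract (1 / (u : ℚ)))) (m k : ℕ) :
    u ∣ tDen a (m + k * g) ↔ u ∣ tDen a m := by
  induction k with
  | zero => simp
  | succ k ih => rw [← ih, add_mul, one_mul, ← add_assoc, dvd_tDen_iff hu horb]

/-- Coprimality of the first two denominators excludes that `u`, not being a unit, divides both;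
periodicity modulo `u` spreads the nondivisible index to infinity. -/
theorem frequently_not_dvd_tDen {a g : ℕ} (hg : 0 < g) {u : ℤ} (hu : 1 < |u|)
    (horb : (orbitStep a)^[g] (1, Int.fract (1 / (u : ℚ))) = (1, Int.fract (1 / (u : ℚ)))) :
    ∃ᶠ n in atTop, ¬u ∣ tDen a (n + g) := by
  have hu0 : u ≠ 0 := by rintro rfl; simp at hu
  have h : ¬u ∣ tDen a 0 ∨ ¬u ∣ tDen a 1 := by
    by_contra! h
    have := (isCoprime_tDen a 0).isUnit_of_dvd' h.1 h.2
    rw [Int.isUnit_iff_abs_eq] at this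
    omega
  rw [frequently_atTop]
  intro N
  obtain ⟨m, hm⟩ : ∃ m, ¬u ∣ tDen a m := by
    rcases h with h | h
    exacts [⟨0, h⟩, ⟨1, h⟩]
  refine ⟨m + N * g, ?_, ?_⟩
  · show N ≤ m + N * g
    nlinarith
  · rwa [dvd_tDen_iff hu0 horb, dvd_tDen_mul_iff hu0 horb]

/-! ### The absolute value of the cyclic quantum dilogarithm -/

theorem norm_cyclicDilog {t : ℚ} {z : ℝ} (hz : ∀ n : ℤ, t.den * z ≠ n) :
    ‖cyclicDilog t z‖ = Real.exp (logDilog t.den t z) := by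
  have hd : (t.den : ℝ) ≠ 0 := by exact_mod_cast t.den_nz
  have hpos := t.den_pos
  have htd : (t : ℝ) * t.den = t.num := by exact_mod_cast Rat.mul_den_eq_num t
  rw [cyclicDilog, cyclicDilog₂, norm_prod, logDilog, Finset.range_eq_Ico,
    Finset.sum_eq_sum_Ico_succ_bot hpos, Nat.cast_zero, zero_div]
  simp only [zero_mul, zero_add, add_zero]
  rw [Real.exp_sum]
  refine Finset.prod_congr rfl fun k _ => ?_
  have e : (k : ℂ) / (t.den : ℂ) = ((k / t.den : ℝ) : ℂ) := by push_cast; rfl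
  have hs : Real.sin (Real.pi * (k * t + z)) ≠ 0 := by
    refine sin_pi_mul_ne_zero fun n h => hz (n * t.den - k * t.num) ?_
    push_cast
    rw [← htd, ← h]
    ring
  rw [e, Complex.norm_cpow_real, norm_one_sub_exp,
    Real.rpow_def_of_pos (by positivity), logTwoSin, mul_comm]

theorem cyclicDilog_eq_zero {t : ℚ} {z : ℝ} (hz : ∀ n : ℤ, z ≠ n) {m : ℤ} (hm : t.den * z = m) :
    cyclicDilog t z = 0 := by
  have hd : (t.den : ℝ) ≠ 0 := by exact_mod_cast t.den_nz
  have hdz : (t.den : ℤ) ≠ 0 := by exact_mod_cast t.den_nz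
  have htd : (t : ℝ) * t.den = t.num := by exact_mod_cast Rat.mul_den_eq_num t
  have hc : IsCoprime t.num (t.den : ℤ) :=
    Int.isCoprime_iff_nat_coprime.2 (by simpa using t.reduced)
  obtain ⟨r, s, hrs⟩ := hc
  -- Here `r` inverts the numerator modulo the denominator, so this residue solves `k t + z ∈ ℤ`.
  -- Nonintegrality of `z` forces `k ≠ 0`, so the vanishing factor occurs in the product with
  -- positive exponent.
  set k := (-m * r) % (t.den : ℤ) with hk
  have hk0 : 0 ≤ k := Int.emod_nonneg _ hdz
  have hk1 : k < t.den := Int.emod_lt_of_pos _ (by exact_mod_cast t.den_pos)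
  have hkr : k = -m * r - t.den * ((-m * r) / t.den) := by rw [hk, Int.emod_def]
  set c := (-m * r) / (t.den : ℤ)
  have hsum : k * t.num + m = t.den * (s * m - c * t.num) := by
    rw [hkr]
    linear_combination (-m) * hrs
  have hint : (k : ℝ) * t + z = ((s * m - c * t.num : ℤ) : ℝ) := by
    have h1 : (k : ℝ) * t.num + m = t.den * ((s * m - c * t.num : ℤ) : ℝ) := by exact_mod_cast hsum
    refine mul_left_cancel₀ hd ?_
    rw [← h1, ← htd, ← hm]
    ring
  have hkpos : 0 < k := by
    refine lt_of_le_of_ne hk0 fun h => hz (s * m - c * t.num) ?_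
    rw [← hint, ← h]
    simp
  obtain ⟨j, hj⟩ := Int.eq_ofNat_of_zero_le hk0
  rw [cyclicDilog, cyclicDilog₂]
  have hj0 : 0 < j := by omega
  refine Finset.prod_eq_zero (i := j) (Finset.mem_Ico.2 ⟨hj0, by omega⟩) ?_
  have hkj : (k : ℝ) = j := by rw [hj]; simp
  rw [zero_mul, add_zero, ← hkj, hint]
  have h1 : Complex.exp (2 * Real.pi * Complex.I * (((s * m - c * t.num : ℤ) : ℝ) : ℂ)) = 1 := by
    rw [Complex.exp_eq_one_iff]
    exact ⟨s * m - c * t.num, by push_cast; ring⟩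
  rw [h1, sub_self, Complex.zero_cpow]
  refine div_ne_zero ?_ (by exact_mod_cast t.den_nz)
  exact_mod_cast hj0.ne'

theorem one_div_ne_int {u : ℤ} (hu : 1 < |u|) (n : ℤ) : 1 / (u : ℝ) ≠ n := by
  intro h
  refine fract_one_div_ne_zero hu ?_
  have : 1 / (u : ℚ) = n := by exact_mod_cast h
  rw [this, Int.fract_intCast]

theorem mul_one_div_ne_int {u N : ℤ} (hu : u ≠ 0) (hN : ¬u ∣ N) (n : ℤ) :
    (N : ℝ) * (1 / u) ≠ n := by
  intro h
  have hu' : (u : ℝ) ≠ 0 := by exact_mod_cast hu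
  refine hN ⟨n, ?_⟩
  field_simp at h
  exact_mod_cast h

theorem cyclicDilog_tSeq_ne_zero_iff {a : ℕ} (ha : 3 ≤ a) {u : ℤ} (hu : 1 < |u|) (n : ℕ) :
    cyclicDilog (tSeq a (n + 1)) (1 / (u : ℝ)) ≠ 0 ↔ ¬u ∣ tDen a (n + 1) := by
  have hu0 : u ≠ 0 := by rintro rfl; simp at hu
  have hu' : (u : ℝ) ≠ 0 := by exact_mod_cast hu0
  have hden : (((tSeq a (n + 1)).den : ℕ) : ℝ) = tDen a (n + 1) := by exact_mod_cast tSeq_den ha n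
  constructor
  · rintro h ⟨m, hm⟩
    refine h (cyclicDilog_eq_zero (one_div_ne_int hu) (m := m) ?_)
    rw [hden, hm]
    push_cast
    field_simp
  · intro h
    rw [← norm_ne_zero_iff, norm_cyclicDilog]
    · positivity
    · rw [hden]
      exact mul_one_div_ne_int hu0 h

/-! ### The limit formula -/

/-- `log |D_t(y, x)|` for `t = tSeq a (k + 1)` and the pair `(x, y)`. -/
def dilogPair (a k : ℕ) (p : ℚ × ℚ) : ℝ :=
  logDilog (tDen a (k + 1)).toNat (tDen a k / tDen a (k + 1))
    (p.2 * (tDen a k / tDen a (k + 1)) + p.1)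

theorem dilogPair_orbitStep_one_fract (a k : ℕ) (u : ℤ) :
    dilogPair a k (orbitStep a (1, Int.fract (1 / (u : ℚ)))) =
      logDilog (tDen a (k + 1)).toNat (tDen a k / tDen a (k + 1)) (1 / u) := by
  obtain ⟨n₁, h₁⟩ := exists_fractOne_eq (a * 1 + Int.fract (1 / (u : ℚ)))
  obtain ⟨n₂, h₂⟩ := exists_fract_eq (1 / (u : ℚ))
  have e1 : (orbitStep a (1, Int.fract (1 / (u : ℚ)))).1 = 1 / (u : ℚ) + ((a + n₂ + n₁ : ℤ) : ℚ) := by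
    rw [orbitStep_eq]
    simp only
    rw [h₁, h₂]
    push_cast
    ring
  have e2 : (orbitStep a (1, Int.fract (1 / (u : ℚ)))).2 = 0 := by
    rw [(isNormalized_one_fract _).orbitStep_snd, sub_self]
  have e1' : ((orbitStep a (1, Int.fract (1 / (u : ℚ)))).1 : ℝ) =
      1 / (u : ℝ) + ((a + n₂ + n₁ : ℤ) : ℝ) := by
    rw [e1]; push_cast; ring
  rw [dilogPair, e1', e2, Rat.cast_zero, zero_mul, zero_add, logDilog_add_int]

/-- Substituting `logDilog_reflect` into `logSine_rat` leaves the log-sine with coefficient `1 / q -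
x / q - y / p`, of size at most `3 / q`, and a Clausen term divided by `p q`. -/
theorem abs_logSinePair_sub_le {a : ℕ} (ha : 3 ≤ a) (k : ℕ) {P : ℚ × ℚ} (hP : IsNormalized P)
    {J A B : ℝ} (hJ : J = tDen a (k + 2) * P.1 + tDen a (k + 1) * P.2) (hn : ∀ n : ℤ, J ≠ n)
    (hA : |logTwoSin J| ≤ A) (hB : |clausenPart J| ≤ B) :
    |logSinePair (tDen a (k + 2) / tDen a (k + 1)) P -
      (dilogPair a k (orbitStep a P) - dilogPair a (k + 1) P)| ≤
      (3 * A + B) / tDen a (k + 1) := by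
  have hsnd := hP.orbitStep_snd (a := a)
  obtain ⟨n₁, h₁⟩ := exists_fractOne_eq (a * P.1 + P.2)
  have hfst : ((orbitStep a P).1 : ℝ) = (a * P.1 + P.2 : ℝ) + n₁ := by
    rw [orbitStep_eq]; simp only; rw [h₁]; push_cast; ring
  have hsnd' : ((orbitStep a P).2 : ℝ) = 1 - P.1 := by rw [hsnd]; push_cast; ring
  obtain ⟨hx, hx', hy, hy'⟩ := hP
  have hx1 : (0 : ℝ) < P.1 := by exact_mod_cast hx
  have hx2 : (P.1 : ℝ) ≤ 1 := by exact_mod_cast hx'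
  have hy1 : (0 : ℝ) ≤ P.2 := by exact_mod_cast hy
  have hy2 : (P.2 : ℝ) < 1 := by exact_mod_cast hy'
  have hp0 := tDen_pos ha (k + 2)
  have hq0 := tDen_pos ha (k + 1)
  have hlt := (tDen_pos_lt ha (k + 1)).2
  have hcop := (isCoprime_tDen a (k + 1)).symm
  have hcop' := isCoprime_tDen a k
  have hrec : tDen a (k + 2) = (a : ℤ) * tDen a (k + 1) - tDen a k := rfl
  rw [logSinePair, dilogPair, dilogPair, hfst, hsnd']
  set q' := tDen a k
  obtain ⟨p, hp⟩ := Int.eq_ofNat_of_zero_le hp0.le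
  obtain ⟨q, hq⟩ := Int.eq_ofNat_of_zero_le hq0.le
  rw [show k + 1 + 1 = k + 2 from rfl] at *
  rw [hp] at hp0 hcop hlt hrec hJ ⊢
  rw [hq] at hq0 hcop hlt hcop' hrec hJ ⊢
  simp only [Int.toNat_natCast, Int.cast_natCast] at hJ ⊢
  have hp1 : 0 < p := by exact_mod_cast hp0
  have hq1 : 0 < q := by exact_mod_cast hq0
  have hpR : (0 : ℝ) < p := by exact_mod_cast hp1
  have hqR : (0 : ℝ) < q := by exact_mod_cast hq1
  have hpq : (q : ℝ) ≤ p := by exact_mod_cast hlt.le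
  have hp1R : (1 : ℝ) ≤ p := by exact_mod_cast hp1
  have hn' : ∀ n : ℤ, p * (P.1 : ℝ) + q * (P.2 : ℝ) ≠ n := by rwa [hJ] at hn
  have h1 := logSine_rat hp1 hq1 (Nat.isCoprime_iff_coprime.1 hcop) hx1 hx2 hy1 hy2 hn'
  have h2 := logDilog_reflect hq1 hrec hcop' (x := P.1) (y := P.2) (by simpa using hn')
  simp only [Int.cast_natCast] at h2
  rw [← hJ] at h1 h2
  rw [← add_assoc, logDilog_add_int, h1, h2]
  set ℓ := logTwoSin J
  have e : (1 - (P.1 : ℝ) / q - P.2 / p) * ℓ - ((1 - 1 / q) * ℓ - logDilog q (q' / q)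
      ((1 - (P.1 : ℝ)) * (q' / q) + (a * P.1 + P.2))) - logDilog p (q / p) (P.2 * (q / p) + P.1) +
      clausenPart J / (p * q) - (logDilog q (q' / q)
      ((1 - (P.1 : ℝ)) * (q' / q) + (a * P.1 + P.2)) - logDilog p (q / p) (P.2 * (q / p) + P.1)) =
      (1 / q - (P.1 : ℝ) / q - P.2 / p) * ℓ + clausenPart J / (p * q) := by ring
  rw [e]
  have hA0 : 0 ≤ A := (abs_nonneg _).trans hA
  have hB0 : 0 ≤ B := (abs_nonneg _).trans hB
  have hc : |1 / (q : ℝ) - P.1 / q - P.2 / p| ≤ 3 / q := by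
    have a1 : (P.1 : ℝ) / q ≤ 1 / q := by gcongr
    have a2 : (P.2 : ℝ) / p ≤ 1 / q := by gcongr
    have a3 : (0 : ℝ) ≤ P.1 / q := by positivity
    have a4 : (0 : ℝ) ≤ P.2 / p := by positivity
    have a5 : (3 : ℝ) / q = 1 / q + 1 / q + 1 / q := by ring
    have a6 : (0 : ℝ) ≤ 1 / q := by positivity
    rw [abs_le, a5]
    constructor <;> linarith
  refine (abs_add_le _ _).trans ?_
  rw [add_div]
  refine add_le_add ?_ ?_
  · rw [abs_mul]
    calc |1 / (q : ℝ) - P.1 / q - P.2 / p| * |ℓ| ≤ 3 / q * A := by gcongr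
      _ = _ := by ring
  · rw [abs_div, abs_of_pos (mul_pos hpR hqR)]
    have : (q : ℝ) ≤ p * q := by nlinarith
    gcongr

/-- The argument takes only finitely many values modulo `1`. The integral value causes no trouble,
since `Real.log 0 = 0`. -/
theorem exists_bound_logTwoSin {u : ℤ} (hu : u ≠ 0) : ∃ A : ℝ, ∀ N n : ℤ,
    |logTwoSin (N * (1 / u) + n)| ≤ A := by
  have hu' : (u : ℝ) ≠ 0 := by exact_mod_cast hu
  refine ⟨∑ r ∈ Finset.range u.natAbs, |logTwoSin (r * (1 / u))|, fun N n => ?_⟩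
  obtain ⟨r, hr⟩ := Int.eq_ofNat_of_zero_le (Int.emod_nonneg N hu)
  have hlt : r < u.natAbs := by
    have := Int.emod_lt_abs N hu
    rw [hr, Int.abs_eq_natAbs] at this
    exact_mod_cast this
  have hN : (N : ℝ) = u * (N / u : ℤ) + r := by
    have := Int.mul_ediv_add_emod N u
    rw [hr] at this
    exact_mod_cast this.symm
  have e : (N : ℝ) * (1 / u) + n = r * (1 / u) + ((N / u + n : ℤ) : ℝ) := by
    rw [hN, Int.cast_add]
    field_simp
    ring
  rw [e, periodic_add_int logTwoSin_add_one]
  exact Finset.single_le_sum (f := fun r : ℕ => |logTwoSin (r * (1 / u))|)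
    (fun _ _ => abs_nonneg _) (Finset.mem_range.2 hlt)

theorem exists_bound_sum_logSinePair {a g : ℕ} (ha : 3 ≤ a) {u : ℤ} (hu : 1 < |u|)
    (horb : (orbitStep a)^[g] (1, Int.fract (1 / (u : ℚ))) = (1, Int.fract (1 / (u : ℚ)))) :
    ∃ E : ℝ, 0 ≤ E ∧ ∀ s : ℕ, ¬u ∣ tDen a (s + 1 + g) →
      |(∑ i ∈ Finset.range g, logSinePair (tDen a (s + i + 2) / tDen a (s + i + 1))
          ((orbitStep a)^[g - i] (1, Int.fract (1 / (u : ℚ))))) -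
        (logDilog (tDen a (s + 1)).toNat (tDen a s / tDen a (s + 1)) (1 / u) -
          logDilog (tDen a (s + g + 1)).toNat (tDen a (s + g) / tDen a (s + g + 1)) (1 / u))| ≤
        E / (s + 1) := by
  have hu0 : u ≠ 0 := by rintro rfl; simp at hu
  obtain ⟨A, hA⟩ := exists_bound_logTwoSin hu0
  obtain ⟨B, hB⟩ := exists_bound_clausenPart
  have hA0 : 0 ≤ A := (abs_nonneg _).trans (hA 0 0)
  have hB0 : 0 ≤ B := (abs_nonneg _).trans (hB _ (one_div_ne_int hu))
  refine ⟨g * (3 * A + B), by positivity, fun s hs => ?_⟩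
  set p : ℚ × ℚ := (1, Int.fract (1 / (u : ℚ))) with hp
  -- Both ends of the telescope lie at the successor of the starting pair, the lower one by
  -- closedness. That successor is `(1/u, 0)` modulo `1`, which gives dilogarithms at `1/u`.
  have htel := Finset.sum_range_sub' (fun i => dilogPair a (s + i) ((orbitStep a)^[g + 1 - i] p)) g
  rw [Nat.sub_zero, Nat.add_sub_cancel_left, add_zero, Function.iterate_one,
    Function.iterate_succ_apply', horb, hp, dilogPair_orbitStep_one_fract,
    dilogPair_orbitStep_one_fract, ← hp] at htel
  rw [← htel, ← Finset.sum_sub_distrib]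
  have hterm : ∀ i ∈ Finset.range g,
      |logSinePair (tDen a (s + i + 2) / tDen a (s + i + 1)) ((orbitStep a)^[g - i] p) -
        (dilogPair a (s + i) ((orbitStep a)^[g + 1 - i] p) -
          dilogPair a (s + (i + 1)) ((orbitStep a)^[g + 1 - (i + 1)] p))| ≤
        (3 * A + B) / (s + 1) := by
    intro i hi
    have hi' := Finset.mem_range.1 hi
    rw [show g + 1 - i = (g - i) + 1 by omega, show g + 1 - (i + 1) = g - i by omega,
      Function.iterate_succ_apply', ← add_assoc]
    -- The denominator index grows with `i` and the orbit index `g - i` falls, so their sum, and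
    -- with it `J` modulo `1`, is the same for all terms.
    obtain ⟨n, h⟩ := exists_iterate_one_fract_eq a (s + i + 1) (g - i) (1 / (u : ℚ))
    rw [← hp, show s + i + 1 + (g - i) = s + 1 + g by omega] at h
    have hR := congrArg (Rat.cast : ℚ → ℝ) h
    push_cast at hR
    have hn : ∀ m : ℤ, (tDen a (s + 1 + g) : ℝ) * (1 / u) + n ≠ m := by
      intro m hm
      refine mul_one_div_ne_int hu0 hs (m - n) ?_
      push_cast
      linarith
    refine (abs_logSinePair_sub_le ha (s + i) ((isNormalized_one_fract _).iterate _) hR.symm hn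
      (hA _ _) (hB _ hn)).trans ?_
    have hle : ((s + 1 : ℕ) : ℤ) ≤ tDen a (s + i + 1) :=
      (by push_cast; omega : ((s + 1 : ℕ) : ℤ) ≤ ((s + i + 1 : ℕ) : ℤ)).trans (le_tDen ha _)
    have hle' : ((s : ℝ) + 1) ≤ tDen a (s + i + 1) := by exact_mod_cast hle
    gcongr
  refine (Finset.abs_sum_le_sum_abs _ _).trans ((Finset.sum_le_sum hterm).trans (le_of_eq ?_))
  rw [Finset.sum_const, Finset.card_range, nsmul_eq_mul]
  ring

theorem norm_cyclicDilog_tSeq {a : ℕ} (ha : 3 ≤ a) {u : ℤ} (hu : u ≠ 0) {s : ℕ}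
    (hs : ¬u ∣ tDen a (s + 1)) :
    ‖cyclicDilog (tSeq a (s + 1)) (1 / (u : ℝ))‖ =
      Real.exp (logDilog (tDen a (s + 1)).toNat (tDen a s / tDen a (s + 1)) (1 / u)) := by
  have hden := tSeq_den ha s
  have hden' : (((tSeq a (s + 1)).den : ℕ) : ℝ) = tDen a (s + 1) := by exact_mod_cast hden
  rw [norm_cyclicDilog, ← hden, Int.toNat_natCast, hden, tSeq_succ ha]
  · push_cast; rfl
  · rw [hden']
    exact mul_one_div_ne_int hu hs

theorem tendsto_norm_cyclicDilog {a g : ℕ} (ha : 3 ≤ a) {u : ℤ} (hu : 1 < |u|)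
    (horb : (orbitStep a)^[g] (1, Int.fract (1 / (u : ℚ))) = (1, Int.fract (1 / (u : ℚ))))
    {e e' : ℝ} (he : e + e' = a) (hee : e * e' = 1) (he1 : 1 < e) :
    Tendsto (fun n : ℕ => ‖cyclicDilog (tSeq a n) (1 / (u : ℝ)) /
        cyclicDilog (tSeq a (n + g)) (1 / (u : ℝ))‖)
      (atTop ⊓ 𝓟 {n : ℕ | cyclicDilog (tSeq a (n + g)) (1 / (u : ℝ)) ≠ 0})
      (𝓝 (Real.exp (∑ l ∈ Finset.range g,
        logSinePair e ((orbitStep a)^[l] (1, Int.fract (1 / (u : ℚ))))))) := by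
  have hu0 : u ≠ 0 := by rintro rfl; simp at hu
  set p : ℚ × ℚ := (1, Int.fract (1 / (u : ℚ))) with hp
  set F := atTop ⊓ 𝓟 {n : ℕ | cyclicDilog (tSeq a (n + g)) (1 / (u : ℝ)) ≠ 0} with hF
  obtain ⟨E, hE0, hE⟩ := exists_bound_sum_logSinePair ha hu horb
  set S : ℕ → ℝ := fun s => ∑ i ∈ Finset.range g,
    logSinePair (tDen a (s + i + 2) / tDen a (s + i + 1)) ((orbitStep a)^[g - i] p) with hS
  have he0 : 0 < e := by linarith
  have hlimS : Tendsto S atTop (𝓝 (∑ l ∈ Finset.range g, logSinePair e ((orbitStep a)^[l] p))) := by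
    have e1 : ∑ l ∈ Finset.range g, logSinePair e ((orbitStep a)^[l] p) =
        ∑ i ∈ Finset.range g, logSinePair e ((orbitStep a)^[g - i] p) := by
      rw [← sum_orbit_succ horb, ← Finset.sum_range_reflect]
      refine Finset.sum_congr rfl fun i hi => ?_
      have := Finset.mem_range.1 hi
      rw [show g - 1 - i + 1 = g - i by omega]
    rw [e1]
    refine tendsto_finsetSum _ fun i _ => ?_
    have hρ : Tendsto (fun s : ℕ => (tDen a (s + i + 2) : ℝ) / tDen a (s + i + 1)) atTop (𝓝 e) := by
      have := (tendsto_tDen_ratio he hee he1).comp (tendsto_add_atTop_nat (i + 1))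
      exact this
    have hb := ((isNormalized_one_fract (1 / (u : ℚ))).iterate (a := a) (g - i)).pos_lt he0
    exact tendsto_logSine hρ ((hρ.const_mul _).add_const _) he0 hb.1 hb.2
  have hev : ∀ᶠ n in F, ∃ s, n = s + 1 ∧ ¬u ∣ tDen a (s + 1 + g) := by
    have h1 : ∀ᶠ n in F, 1 ≤ n := (eventually_ge_atTop 1).filter_mono inf_le_left
    have h2 : ∀ᶠ n in F, cyclicDilog (tSeq a (n + g)) (1 / (u : ℝ)) ≠ 0 :=
      (eventually_principal.2 fun n hn => hn).filter_mono inf_le_right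
    filter_upwards [h1, h2] with n hn1 hn2
    obtain ⟨s, rfl⟩ : ∃ s, n = s + 1 := ⟨n - 1, by omega⟩
    refine ⟨s, rfl, ?_⟩
    rw [show s + 1 + g = (s + g) + 1 by ring] at hn2 ⊢
    exact (cyclicDilog_tSeq_ne_zero_iff ha hu _).1 hn2
  set f : ℕ → ℝ := fun n => Real.log ‖cyclicDilog (tSeq a n) (1 / (u : ℝ)) /
    cyclicDilog (tSeq a (n + g)) (1 / (u : ℝ))‖ with hf
  have hval : ∀ᶠ n in F, ‖cyclicDilog (tSeq a n) (1 / (u : ℝ)) /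
      cyclicDilog (tSeq a (n + g)) (1 / (u : ℝ))‖ = Real.exp (f n) ∧
      ‖f n - S (n - 1)‖ ≤ E / n := by
    filter_upwards [hev] with n hn
    obtain ⟨s, rfl, hs⟩ := hn
    -- Periodicity modulo `u` makes the numerator of the quotient nonzero together with its
    -- denominator, so the logarithm is the expected one.
    have hs' : ¬u ∣ tDen a (s + 1) := by rwa [dvd_tDen_iff hu0 horb] at hs
    have hs2 : ¬u ∣ tDen a (s + g + 1) := by rwa [show s + g + 1 = s + 1 + g by ring]
    have e1 : ‖cyclicDilog (tSeq a (s + 1)) (1 / (u : ℝ)) /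
        cyclicDilog (tSeq a (s + 1 + g)) (1 / (u : ℝ))‖ = Real.exp
        (logDilog (tDen a (s + 1)).toNat (tDen a s / tDen a (s + 1)) (1 / u) -
          logDilog (tDen a (s + g + 1)).toNat (tDen a (s + g) / tDen a (s + g + 1)) (1 / u)) := by
      rw [norm_div, norm_cyclicDilog_tSeq ha hu0 hs', show s + 1 + g = s + g + 1 by ring,
        norm_cyclicDilog_tSeq ha hu0 hs2, Real.exp_sub]
    simp only [hf]
    rw [e1, Real.log_exp]
    refine ⟨rfl, ?_⟩
    rw [norm_sub_rev, Real.norm_eq_abs, Nat.add_sub_cancel]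
    push_cast
    exact hE s hs
  have hdiff : Tendsto (fun n => f n - S (n - 1)) F (𝓝 0) := by
    refine squeeze_zero_norm' (hval.mono fun n hn => hn.2) ?_
    exact (tendsto_const_div_atTop_nhds_zero_nat E).mono_left inf_le_left
  have hlimf : Tendsto f F (𝓝 (∑ l ∈ Finset.range g, logSinePair e ((orbitStep a)^[l] p))) := by
    have h := hdiff.add ((hlimS.comp (tendsto_sub_atTop_nat 1)).mono_left
      (inf_le_left : F ≤ atTop))
    rw [zero_add] at h
    refine h.congr fun n => ?_
    simp
  refine ((Real.continuous_exp.tendsto _).comp hlimf).congr' ?_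
  filter_upwards [hval] with n hn
  exact hn.1.symm

theorem frequently_cyclicDilog_ne_zero {a g : ℕ} (ha : 3 ≤ a) (hg : 0 < g) {u : ℤ} (hu : 1 < |u|)
    (horb : (orbitStep a)^[g] (1, Int.fract (1 / (u : ℚ))) = (1, Int.fract (1 / (u : ℚ)))) :
    ∃ᶠ n : ℕ in atTop, cyclicDilog (tSeq a (n + g)) (1 / (u : ℝ)) ≠ 0 := by
  refine (frequently_not_dvd_tDen hg hu horb).mono fun n hn => ?_
  obtain ⟨k, rfl⟩ : ∃ k, g = k + 1 := ⟨g - 1, by omega⟩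
  rw [← add_assoc] at hn ⊢
  exact (cyclicDilog_tSeq_ne_zero_iff ha hu _).2 hn

/-! ### The fundamental totally positive unit -/

theorem irreducible_X_sq_sub_C {d : ℕ} (hd : 1 < d) (hsq : Squarefree d) :
    Irreducible (Polynomial.X ^ 2 - Polynomial.C (d : ℚ)) := by
  refine (X_pow_sub_C_irreducible_iff_of_prime Nat.prime_two).2 fun r hr => ?_
  have h : IsSquare (d : ℚ) := ⟨r, by rw [← hr, sq]⟩
  rw [Rat.isSquare_natCast_iff] at h
  obtain ⟨m, rfl⟩ := h
  have := Nat.isUnit_iff.1 (hsq m dvd_rfl)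
  subst this
  omega

/-- The real embeddings of a real quadratic field. -/
theorem exists_ringHom_real {K : Type*} [Field K] [NumberField K]
    (hK : Module.finrank ℚ K = 2) {d : ℕ} (hd : 1 < d) (hsq : Squarefree d) {δ : K}
    (hδ : δ ^ 2 = (d : K)) {r : ℝ} (hr : r ^ 2 = d) : ∃ φ : K →+* ℝ, φ δ = r := by
  set P : Polynomial ℚ := Polynomial.X ^ 2 - Polynomial.C (d : ℚ) with hP
  have hirr : Irreducible P := irreducible_X_sq_sub_C hd hsq
  have : Fact (Irreducible P) := ⟨hirr⟩
  have hδP : Polynomial.aeval δ P = 0 := by simp [hP, hδ]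
  have hrP : Polynomial.aeval r P = 0 := by simp [hP, hr]
  let f : AdjoinRoot P →ₐ[ℚ] K := AdjoinRoot.liftAlgHom P (Algebra.ofId ℚ K) δ hδP
  let h : AdjoinRoot P →ₐ[ℚ] ℝ := AdjoinRoot.liftAlgHom P (Algebra.ofId ℚ ℝ) r hrP
  have hfin : Module.finrank ℚ (AdjoinRoot P) = Module.finrank ℚ K := by
    rw [hK, (AdjoinRoot.powerBasis hirr.ne_zero).finrank, AdjoinRoot.powerBasis_dim, hP,
      Polynomial.natDegree_X_pow_sub_C]
  have : FiniteDimensional ℚ (AdjoinRoot P) :=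
    (AdjoinRoot.powerBasis hirr.ne_zero).finite
  have hinj : Function.Injective f := f.toRingHom.injective
  have hbij : Function.Bijective f :=
    ⟨hinj, (LinearMap.injective_iff_surjective_of_finrank_eq_finrank hfin
      (f := f.toLinearMap)).1 hinj⟩
  let e := AlgEquiv.ofBijective f hbij
  refine ⟨h.toRingHom.comp e.symm.toRingEquiv.toRingHom, ?_⟩
  have h1 : e.symm δ = AdjoinRoot.root P := by
    rw [AlgEquiv.symm_apply_eq]
    exact (AdjoinRoot.liftAlgHom_root P (Algebra.ofId ℚ K) δ hδP).symm
  show h (e.symm δ) = r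
  rw [h1]
  exact AdjoinRoot.liftAlgHom_root P (Algebra.ofId ℚ ℝ) r hrP

theorem mem_range_int_of_isIntegral {x : ℝ} {q : ℚ} (hx : IsIntegral ℤ x) (hq : x = q) :
    ∃ n : ℤ, x = n := by
  have h : IsIntegral ℤ q := by
    rw [hq] at hx
    exact (isIntegral_algebraMap_iff (algebraMap ℚ ℝ).injective).1 hx
  obtain ⟨n, hn⟩ := IsIntegrallyClosed.isIntegral_iff.1 h
  exact ⟨n, by rw [hq, ← hn]; simp⟩

/-- The products of the two real conjugates of `ε` and of `ε⁻¹` are rational algebraic integers,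
hence integers, and mutually inverse. Total positivity excludes `-1`. -/
theorem sq_sub_eq_four {K : Type*} [Field K] [NumberField K]
    (hK : Module.finrank ℚ K = 2)
    {d : ℕ} (hd : 1 < d) (hsq : Squarefree d) {δ : K} (hδ : δ ^ 2 = (d : K))
    {a b : ℕ} {ε : (NumberField.RingOfIntegers K)ˣ}
    (hε : ((ε : NumberField.RingOfIntegers K) : K) = ((a : K) + (b : K) * δ) / 2)
    (hpos : TotallyPositive ((ε : NumberField.RingOfIntegers K) : K)) :
    ((a + b * Real.sqrt d) / 2) * ((a - b * Real.sqrt d) / 2) = 1 := by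
  have hd0 : (0 : ℝ) ≤ d := d.cast_nonneg
  obtain ⟨φ, hφ⟩ := exists_ringHom_real hK hd hsq hδ (Real.sq_sqrt hd0)
  obtain ⟨ψ, hψ⟩ := exists_ringHom_real hK hd hsq hδ (r := -Real.sqrt d)
    (by rw [neg_sq, Real.sq_sqrt hd0])
  have eφ : φ ((ε : NumberField.RingOfIntegers K) : K) = (a + b * Real.sqrt d) / 2 := by
    rw [hε]; simp [hφ, map_ofNat]
  have eψ : ψ ((ε : NumberField.RingOfIntegers K) : K) = (a - b * Real.sqrt d) / 2 := by
    rw [hε]; simp [hψ, map_ofNat, sub_eq_add_neg]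
  have p1 := hpos φ
  have p2 := hpos ψ
  have hint (w : NumberField.RingOfIntegers K) (χ : K →+* ℝ) : IsIntegral ℤ (χ (w : K)) :=
    (NumberField.RingOfIntegers.isIntegral_coe w).map χ.toIntAlgHom
  have hinv (χ : K →+* ℝ) : χ ((ε : NumberField.RingOfIntegers K) : K) *
      χ (((ε⁻¹ : (NumberField.RingOfIntegers K)ˣ) : NumberField.RingOfIntegers K) : K) = 1 := by
    rw [← map_mul, ← map_mul, ← Units.val_mul, mul_inv_cancel]
    simp
  set x := φ ((ε : NumberField.RingOfIntegers K) : K) * ψ ((ε : NumberField.RingOfIntegers K) : K)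
    with hx
  set y := φ (((ε⁻¹ : (NumberField.RingOfIntegers K)ˣ) : NumberField.RingOfIntegers K) : K) *
    ψ (((ε⁻¹ : (NumberField.RingOfIntegers K)ˣ) : NumberField.RingOfIntegers K) : K) with hy
  have hxy : x * y = 1 := by
    rw [hx, hy, mul_mul_mul_comm, hinv, hinv, one_mul]
  have hx0 : 0 < x := mul_pos p1 p2
  have hxq : x = (((a : ℚ) ^ 2 - d * b ^ 2) / 4 : ℚ) := by
    rw [hx, eφ, eψ]
    push_cast
    have := Real.sq_sqrt hd0
    linear_combination (-(b : ℝ) ^ 2 / 4) * this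
  have hyq : y = ((((a : ℚ) ^ 2 - d * b ^ 2) / 4)⁻¹ : ℚ) := by
    rw [Rat.cast_inv, ← hxq]
    exact eq_inv_of_mul_eq_one_right hxy
  obtain ⟨m, hm⟩ := mem_range_int_of_isIntegral ((hint _ φ).mul (hint _ ψ)) hxq
  obtain ⟨n, hn⟩ := mem_range_int_of_isIntegral ((hint _ φ).mul (hint _ ψ)) hyq
  rw [← eφ, ← eψ]
  have hmn : m * n = 1 := by
    have : (m : ℝ) * n = 1 := by rw [← hm, ← hn]; exact hxy
    exact_mod_cast this
  have hm0 : 0 < m := by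
    have : (0 : ℝ) < m := by rw [← hm]; exact hx0
    exact_mod_cast this
  have : m = 1 := Int.eq_one_of_mul_eq_one_right hm0.le hmn
  change x = 1
  rw [show x = m from hm, this, Int.cast_one]

end Shintani

end


/-! ### Assembly of the equality, the nonvanishing and the limit. -/

theorem mainTheorem2 {K : Type*} [Field K] [NumberField K]
    (hK : Module.finrank ℚ K = 2)
    (d : ℕ) (hd : 1 < d) (hsq : Squarefree d) (δ : K) (hδ : δ ^ 2 = (d : K))
    (a b : ℕ) (ha : 0 < a) (hb : 0 < b)
    (ε : (NumberField.RingOfIntegers K)ˣ)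
    (hε : ((ε : NumberField.RingOfIntegers K) : K) = ((a : K) + (b : K) * δ) / 2)
    (hgen : ∀ w : (NumberField.RingOfIntegers K)ˣ,
      w ∈ Subgroup.zpowers ε ↔
        Shintani.TotallyPositive ((w : NumberField.RingOfIntegers K) : K))
    (u : ℤ) (hu : 1 < |u|)
    (g : ℕ)
    (hg : Shintani.IsUnitIndex ε (Ideal.span {(u : NumberField.RingOfIntegers K)}) g)
    -- the normalized orbit of `(x, y)` under `U` is indexed by `l = 1, ..., g`
    (horb : (Shintani.orbitStep a)^[g] (Shintani.initialPair d a b u 0) =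
      Shintani.initialPair d a b u 0) :
    Shintani.X₁ d a b u 0 g = Shintani.X₂ d a b u 0 g ∧
    -- the quotients are defined for infinitely many `n`, and converge along these
    (∃ᶠ n : ℕ in atTop,
      Shintani.cyclicDilog (Shintani.tSeq a (n + g)) (1 / (u : ℝ)) ≠ 0) ∧
    Tendsto
      (fun n : ℕ =>
        ((‖Shintani.cyclicDilog (Shintani.tSeq a n) (1 / (u : ℝ)) /
            Shintani.cyclicDilog (Shintani.tSeq a (n + g)) (1 / (u : ℝ))‖ : ℝ) : ℂ))
      (atTop ⊓ 𝓟 {n : ℕ |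
        Shintani.cyclicDilog (Shintani.tSeq a (n + g)) (1 / (u : ℝ)) ≠ 0})
      (𝓝 (Shintani.X₁ d a b u 0 g)) := by
  have hu0 : u ≠ 0 := by rintro rfl; simp at hu
  have hpos : Shintani.TotallyPositive ((ε : NumberField.RingOfIntegers K) : K) :=
    (hgen ε).1 (Subgroup.mem_zpowers ε)
  have hee := Shintani.sq_sub_eq_four hK hd hsq hδ hε hpos
  rw [Shintani.initialPair_zero d a hb hu0] at horb
  have hg0 : 0 < g := hg.1.1
  set e : ℝ := (a + b * Real.sqrt d) / 2 with he
  set e' : ℝ := (a - b * Real.sqrt d) / 2 with he'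
  have hsum : e + e' = a := by rw [he, he']; ring
  have hs := Real.sq_sqrt (Nat.cast_nonneg d : (0 : ℝ) ≤ d)
  have hs0 : 1 < Real.sqrt d := by
    rw [Real.lt_sqrt zero_le_one]
    exact_mod_cast (by omega : 1 ^ 2 < d)
  have hbR : (1 : ℝ) ≤ b := by exact_mod_cast hb
  have haR : (0 : ℝ) < a := by exact_mod_cast ha
  have hdR : (2 : ℝ) ≤ d := by exact_mod_cast hd
  -- Norm `1` reads `a² = 4 + b² d`, so `a² > 4`. The bound `a ≥ 3` makes the denominators positive
  -- and strictly increasing.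
  have ha3 : 3 ≤ a := by
    have h1 : (a : ℝ) ^ 2 = 4 + b ^ 2 * d := by
      rw [he, he'] at hee
      linear_combination 4 * hee + (b : ℝ) ^ 2 * hs
    have h2 : a ^ 2 = 4 + b ^ 2 * d := by exact_mod_cast h1
    have h3 : 0 < b ^ 2 * d := by positivity
    nlinarith
  have he1 : 1 < e := by
    have : (3 : ℝ) ≤ a := by exact_mod_cast ha3
    rw [he]
    nlinarith
  have he0 : 0 < e := by linarith
  have hinv : e' = e⁻¹ := eq_inv_of_mul_eq_one_right hee
  have hnorm := Shintani.isNormalized_one_fract (1 / (u : ℚ))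
  have hX₁ : Shintani.X₁ d a b u 0 g = Complex.exp (∑ l ∈ Finset.range g, Shintani.logSinePair e
      ((Shintani.orbitStep a)^[l] (1, Int.fract (1 / (u : ℚ)))) : ℝ) := by
    rw [Shintani.X₁, Shintani.initialPair_zero d a hb hu0, Shintani.orbitProduct_eq hnorm he0]
  refine ⟨?_, Shintani.frequently_cyclicDilog_ne_zero ha3 hg0 hu horb, ?_⟩
  · rw [hX₁, Shintani.X₂, Shintani.initialPair_zero d a hb hu0, ← he', hinv,
      Shintani.orbitProduct_eq hnorm (inv_pos.2 he0),
      Shintani.sum_logSinePair_inv (Shintani.fract_one_div_ne_zero hu) horb he0]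
  · rw [hX₁, ← Complex.ofReal_exp]
    exact (Complex.continuous_ofReal.tendsto _).comp
      (Shintani.tendsto_norm_cyclicDilog ha3 hu horb hsum hee he1)
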